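/- Fix $\sigma>0$ and $\delta>0$. For every sample size $n$ let $X\in\mathbb R^{n\times p}$ be a fixed design matrix with $p=p_n$ columns, $\mu=\mu_n\in\mathbb R^n$, and let $\hat M=\hat M_n:\mathbb R^n\to 2^{\{1,\dots,p\}}$ be a selection rule with range $\mathcal M$ such that the boundary of $\hat M^{-1}(M)$ is Lebesgue-null for every $M\in\mathcal M$. Let $X_M$ denote the submatrix of $X$ with the columns in $M$. Assume: 1. for every $M\in\mathcal M$ the matrix $X_M^TX_M$ is invertible, and the hat matrix is $H_M=X_M(X_M^TX_M)^{-1}X_M^T$; 2. $\operatorname{rank}(H_M)\le |M|\le K$ for every $M\in\mathcal M$, where $K=K_n$ satisfies $K^2\log p=O(\sqrt n)$; 3. $\mathbb E\big[\big(\|\mu-H_{\hat M(y')}\mu\|_2^2\big)^2\big]=O(n)$ for $y'\sim N(\mu,\tau I)$, uniformly in $\sigma^2\le\tau\le(1+\delta)\sigma^2$. Let $y,y_{new}\sim N(\mu,\sigma^2I)$ be independent, and let $\mathrm{Err}=\mathbb E\|y_{new}-H_{\hat M(y)}y\|_2^2$. For $\alpha>0$ let $\omega\sim N(0,\alpha\sigma^2I)$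 be independent of $y$, $y^*=y+\omega$, $y^-=y-\omega/\alpha$, and $$\widehat{\mathrm{Err}}_\alpha=\|y^--H_{\hat M(y^*)}y\|_2^2+2\operatorname{tr}(H_{\hat M(y^*)})\sigma^2-\frac{n\sigma^2}{\alpha}.$$ Then $\mathrm{Err}$ is finite, $\widehat{\mathrm{Err}}_\alpha$ has a finite second moment for every $\alpha>0$, and, as $n\to\infty$, uniformly in $0<\alpha\le\delta$, $$\frac1n\left|\mathbb E\,\widehat{\mathrm{Err}}_\alpha-\mathrm{Err}\right|=O(\alpha),\qquad \operatorname{Var}\Big[\tfrac1n\widehat{\mathrm{Err}}_\alpha\Big]=O\Big(\frac1{n\alpha^2}\Big).$$ Furthermore, for $\alpha=n^{-1/4}$, $$\mathbb E\Big[\tfrac1{n^2}\big(\widehat{\mathrm{Err}}_\alpha-\mathrm{Err}\big)^2\Big]=O(n^{-1/2}),$$ so that $\tfrac1n\widehat{\mathrm{Err}}_\alpha-\tfrac1n\mathrm{Err}\to0$ in $L^2$ as $n\to\infty$. -/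

import Mathlib

open MeasureTheory ProbabilityTheory Filter Asymptotics
open scoped Topology Matrix

noncomputable section

namespace SelectionPrediction

/-- The law `N(μ, τ I)` on `ℝⁿ` (variance `τ` in every coordinate, independent coordinates). -/
def isoGaussian {n : ℕ} (μ : EuclideanSpace ℝ (Fin n)) (τ : ℝ) :
    Measure (EuclideanSpace ℝ (Fin n)) :=
  multivariateGaussian μ (τ • (1 : Matrix (Fin n) (Fin n) ℝ))

/-- `X_M`, the submatrix of the design matrix `X` made of the columns in `M`. -/
def subDesign {n p : ℕ} (X : Matrix (Fin n) (Fin p) ℝ) (M : Finset (Fin p)) :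
    Matrix (Fin n) M ℝ :=
  X.submatrix id Subtype.val

/-- The hat matrix `H_M = X_M (X_Mᵀ X_M)⁻¹ X_Mᵀ`. -/
def hatMatrix {n p : ℕ} (X : Matrix (Fin n) (Fin p) ℝ) (M : Finset (Fin p)) :
    Matrix (Fin n) (Fin n) ℝ :=
  subDesign X M * ((subDesign X M)ᵀ * subDesign X M)⁻¹ * (subDesign X M)ᵀ

/-- The vector `H_M v`. -/
def fit {n p : ℕ} (X : Matrix (Fin n) (Fin p) ℝ) (M : Finset (Fin p))
    (v : EuclideanSpace ℝ (Fin n)) : EuclideanSpace ℝ (Fin n) :=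
  WithLp.toLp 2 (hatMatrix X M *ᵥ v.ofLp)

/-- The loss `‖y_new - H_{M̂(y)} y‖²` at the pair `z = (y, y_new)`. -/
def predLoss {n p : ℕ} (X : Matrix (Fin n) (Fin p) ℝ)
    (Mhat : EuclideanSpace ℝ (Fin n) → Finset (Fin p))
    (z : EuclideanSpace ℝ (Fin n) × EuclideanSpace ℝ (Fin n)) : ℝ :=
  ‖z.2 - fit X (Mhat z.1) z.1‖ ^ 2

/-- The prediction error `Err = E ‖y_new - H_{M̂(y)} y‖²`, where `y` and `y_new` are
independent with law `N(μ, σ² I)`. -/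
def predError {n p : ℕ} (σ : ℝ) (X : Matrix (Fin n) (Fin p) ℝ) (μ : EuclideanSpace ℝ (Fin n))
    (Mhat : EuclideanSpace ℝ (Fin n) → Finset (Fin p)) : ℝ :=
  ∫ z, predLoss X Mhat z ∂((isoGaussian μ (σ ^ 2)).prod (isoGaussian μ (σ ^ 2)))

/-- The joint law of `(y, ω)`: independent, `y ~ N(μ, σ² I)` and `ω ~ N(0, α σ² I)`. -/
def randomizedLaw {n : ℕ} (σ : ℝ) (μ : EuclideanSpace ℝ (Fin n)) (α : ℝ) :
    Measure (EuclideanSpace ℝ (Fin n) × EuclideanSpace ℝ (Fin n)) :=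
  (isoGaussian μ (σ ^ 2)).prod (isoGaussian 0 (α * σ ^ 2))

/-- The estimator `Êrr_α = ‖y⁻ - H_{M̂(y*)} y‖² + 2 tr(H_{M̂(y*)}) σ² - n σ² / α`
at `z = (y, ω)`, with `y* = y + ω` and `y⁻ = y - ω / α`. -/
def errHat {n p : ℕ} (σ : ℝ) (X : Matrix (Fin n) (Fin p) ℝ)
    (Mhat : EuclideanSpace ℝ (Fin n) → Finset (Fin p)) (α : ℝ)
    (z : EuclideanSpace ℝ (Fin n) × EuclideanSpace ℝ (Fin n)) : ℝ :=
  ‖(z.1 - α⁻¹ • z.2) - fit X (Mhat (z.1 + z.2)) z.1‖ ^ 2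
    + 2 * (hatMatrix X (Mhat (z.1 + z.2))).trace * σ ^ 2 - α⁻¹ * n * σ ^ 2

end SelectionPrediction

end

set_option linter.unusedSectionVars false

/-! By invertibility each hat matrix is an orthogonal projection `P_M`, and its trace is the rank of
`P_M`. The error at fixed `n` is controlled by two quantities of order `n`: the fourth moment of the
missed mean `μ - P_M μ` at the selected model, which is assumed, and `E max_M ‖P_M z‖⁴` for a
standard Gaussian `z`, the maximum being over all models.

Envelope. The second quantity handles the dependence between the noise and the selected model. A
maximum of chi-squared variables of degree at most `K` over at most `(p+1)^K` models has size `K log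
p`, up to constants, so its square has mean `O(n)` by the rate condition. `projEnvelope` makes this
quantitative by bounding the maximum by a sum of exponentials.

Bias. Rotating the two noise vectors gives independent `a`, `b` such that `y*` depends on `a` only
and `y⁻` on `b` only. Given `a`, the model is frozen and `b` can be integrated exactly
(`integral_modelErr`). Up to `O(α)` times the rank and `‖P a‖²`, the result is the noise term `σ² n`
plus the risk `‖μ - P μ‖² + ‖P u‖²` of the selected model, with `u = y* - μ` of variance `(1+α)σ²`;
`Err` is the same expression at variance `σ²`. A Gaussian expectation is differentiable in the
variance even for discontinuous integrands, and its derivative is the covariance with the score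
`(‖z‖² - n)/(2τ)`. Score and risk both have second moment `O(n)`, so the change is `O(αn)`
(`abs_integral_comp_sqrt_smul_sub_le`).

Variance. It is at most the second moment about `σ² n`. Expanding the square leaves nine terms, each
controlled by the two quantities above or by explicit Gaussian moments; the worst is the fluctuation
of `‖ω/α‖²`, which contributes `n/α²` (`modelErr_second_moment`).

With `α = n^(-1/4)` the squared bias `α²` and the variance `1/(nα²)` are both `n^(-1/2)`. -/

namespace SelectionPrediction

/-! ### Standard Gaussian vectors: densities, moments, rotation invariance. -/

section StandardGaussian

variable {E : Type*} [NormedAddCommGroup E] [InnerProductSpace ℝ E] [FiniteDimensional ℝ E]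
  [MeasurableSpace E] [BorelSpace E]

/-- The density of `N(0, τ I)`. -/
noncomputable def gaussianDensity (τ : ℝ) (u : E) : ℝ :=
  (2 * Real.pi * τ) ^ (-(Module.finrank ℝ E / 2 : ℝ)) * Real.exp (-(2 * τ)⁻¹ * ‖u‖ ^ 2)

theorem gaussianDensity_nonneg {τ : ℝ} (hτ : 0 < τ) (u : E) : 0 ≤ gaussianDensity τ u := by
  unfold gaussianDensity; positivity

theorem continuous_gaussianDensity (τ : ℝ) : Continuous (gaussianDensity τ : E → ℝ) := by
  unfold gaussianDensity; fun_prop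

theorem integrable_exp_neg_mul_norm_sq {b : ℝ} (hb : 0 < b) :
    Integrable fun v : E => Real.exp (-b * ‖v‖ ^ 2) := by
  have h := GaussianFourier.integrable_cexp_neg_mul_sq_norm_add (b := (b : ℂ)) (V := E)
    (by simpa using hb) 0 0
  refine h.norm.congr (ae_of_all _ fun v => ?_)
  simp only [Complex.norm_exp]
  congr 1
  rw [zero_mul, add_zero, ← Complex.ofReal_neg, ← Complex.ofReal_pow, ← Complex.ofReal_mul,
    Complex.ofReal_re]

theorem integrable_gaussianDensity {τ : ℝ} (hτ : 0 < τ) :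
    Integrable (gaussianDensity τ : E → ℝ) :=
  (integrable_exp_neg_mul_norm_sq (by positivity)).const_mul _

theorem charFun_map_smul_stdGaussian (c : ℝ) (t : E) :
    charFun ((stdGaussian E).map fun z => c • z) t
      = Complex.exp (-(c ^ 2 * ‖t‖ ^ 2 : ℝ) / 2) := by
  rw [charFun_map_smul, charFun_stdGaussian]
  congr 1
  rw [← sq_abs c, ← Real.norm_eq_abs, norm_smul]
  push_cast; ring

theorem map_smul_stdGaussian_eq_withDensity {τ : ℝ} (hτ : 0 < τ) :
    (stdGaussian E).map (fun z => √τ • z)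
      = volume.withDensity fun u => ENNReal.ofReal (gaussianDensity τ u) := by
  have hfin : IsFiniteMeasure
      ((volume : Measure E).withDensity fun u => ENNReal.ofReal (gaussianDensity τ u)) :=
    isFiniteMeasure_withDensity_ofReal (integrable_gaussianDensity hτ).2
  have : IsProbabilityMeasure ((stdGaussian E).map fun z => √τ • z) :=
    Measure.isProbabilityMeasure_map (by fun_prop)
  refine Measure.ext_of_charFun ?_
  ext t
  rw [charFun_map_smul_stdGaussian, charFun_apply,
    integral_withDensity_eq_integral_toReal_smul
      (by have := continuous_gaussianDensity (E := E) τ; fun_prop)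
      (ae_of_all _ fun _ => ENNReal.ofReal_lt_top)]
  have hb : 0 < ((2 * τ)⁻¹ : ℝ) := by positivity
  have h := GaussianFourier.integral_cexp_neg_mul_sq_norm_add (b := (((2 * τ)⁻¹ : ℝ) : ℂ)) (V := E)
    (by simpa using hb) Complex.I t
  have hpos : (0 : ℝ) < 2 * Real.pi * τ := by positivity
  have heq : ∀ x : E, (ENNReal.ofReal (gaussianDensity τ x)).toReal •
      Complex.exp (inner ℝ x t * Complex.I)
      = (((2 * Real.pi * τ) ^ (-(Module.finrank ℝ E / 2 : ℝ)) : ℝ) : ℂ) *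
        Complex.exp (-(((2 * τ)⁻¹ : ℝ) : ℂ) * ‖x‖ ^ 2 + Complex.I * inner ℝ t x) := by
    intro x
    rw [ENNReal.toReal_ofReal (gaussianDensity_nonneg hτ x), gaussianDensity, Complex.real_smul,
      Complex.ofReal_mul, Complex.exp_add, Complex.ofReal_exp, real_inner_comm,
      mul_comm Complex.I]
    push_cast; ring
  simp_rw [heq]
  rw [integral_const_mul, h, ← mul_assoc]
  have h1 : ((Real.pi : ℂ) / (((2 * τ)⁻¹ : ℝ) : ℂ)) ^ ((Module.finrank ℝ E : ℂ) / 2)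
      = (((2 * Real.pi * τ) ^ (Module.finrank ℝ E / 2 : ℝ) : ℝ) : ℂ) := by
    rw [Complex.ofReal_cpow hpos.le]
    congr 1
    · push_cast; field_simp
    · push_cast; ring
  rw [h1, ← Complex.ofReal_mul, ← Real.rpow_add hpos, neg_add_cancel, Real.rpow_zero,
    Complex.ofReal_one, one_mul, Complex.I_sq, Real.sq_sqrt hτ.le]
  congr 1
  have : (τ : ℂ) ≠ 0 := by exact_mod_cast hτ.ne'
  push_cast; field_simp; norm_num

theorem integral_comp_smul_stdGaussian {τ : ℝ} (hτ : 0 < τ) {f : E → ℝ} (hf : Measurable f) :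
    ∫ z, f (√τ • z) ∂(stdGaussian E) = ∫ u, gaussianDensity τ u * f u := by
  have h : ∫ z, f (√τ • z) ∂(stdGaussian E)
      = ∫ u, f u ∂((stdGaussian E).map fun z => √τ • z) :=
    (integral_map (by fun_prop) hf.aestronglyMeasurable).symm
  rw [h, map_smul_stdGaussian_eq_withDensity hτ, integral_withDensity_eq_integral_toReal_smul
      (by have := continuous_gaussianDensity (E := E) τ; fun_prop)
      (ae_of_all _ fun _ => ENNReal.ofReal_lt_top)]
  exact integral_congr_ae (ae_of_all _ fun u => by
    simp [ENNReal.toReal_ofReal (gaussianDensity_nonneg hτ u)])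

theorem integrable_gaussianDensity_mul_iff {τ : ℝ} (hτ : 0 < τ) {f : E → ℝ} (hf : Measurable f) :
    Integrable (fun u => gaussianDensity τ u * f u)
      ↔ Integrable (fun z => f (√τ • z)) (stdGaussian E) := by
  have h := integrable_map_measure (μ := stdGaussian E) (f := fun z : E => √τ • z) (g := f)
    hf.aestronglyMeasurable (by fun_prop)
  rw [Function.comp_def] at h
  rw [← h, map_smul_stdGaussian_eq_withDensity hτ, integrable_withDensity_iff_integrable_smul'
      (by have := continuous_gaussianDensity (E := E) τ; fun_prop)
      (ae_of_all _ fun _ => ENNReal.ofReal_lt_top)]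
  refine integrable_congr (ae_of_all _ fun u => ?_)
  simp [ENNReal.toReal_ofReal (gaussianDensity_nonneg hτ u)]

theorem map_smul_stdGaussian_absolutelyContinuous {τ : ℝ} (hτ : 0 < τ) :
    (stdGaussian E).map (fun z => √τ • z) ≪ volume := by
  rw [map_smul_stdGaussian_eq_withDensity hτ]
  exact withDensity_absolutelyContinuous _ _

theorem integrable_norm_pow_stdGaussian (k : ℕ) :
    Integrable (fun z : E => ‖z‖ ^ k) (stdGaussian E) := by
  have h := (IsGaussian.memLp_id (stdGaussian E) k (by simp)).integrable_norm_pow'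
  simpa using h

theorem integrable_exp_norm_sq_stdGaussian :
    Integrable (fun z : E => Real.exp (‖z‖ ^ 2 / 4)) (stdGaussian E) := by
  have h := (integrable_gaussianDensity_mul_iff (E := E) one_pos
    (f := fun z => Real.exp (‖z‖ ^ 2 / 4)) (by fun_prop)).1 ?_
  · simpa using h
  · have h2 := (integrable_exp_neg_mul_norm_sq (E := E) (b := 4⁻¹) (by norm_num)).const_mul
      ((2 * Real.pi * 1) ^ (-(Module.finrank ℝ E / 2 : ℝ)))
    refine h2.congr (ae_of_all _ fun u => ?_)
    simp only [gaussianDensity]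
    rw [mul_assoc _ (Real.exp _) (Real.exp _), ← Real.exp_add]
    ring_nf

/-- The moment generating function of a chi-squared variable at `1/4`; it feeds the union bound over
models. -/
theorem integral_exp_norm_sq_stdGaussian :
    ∫ z : E, Real.exp (‖z‖ ^ 2 / 4) ∂(stdGaussian E) = 2 ^ (Module.finrank ℝ E / 2 : ℝ) := by
  have h := integral_comp_smul_stdGaussian (E := E) one_pos
    (f := fun z => Real.exp (‖z‖ ^ 2 / 4)) (by fun_prop)
  simp only [Real.sqrt_one, one_smul] at h
  rw [h]
  have h2 : ∀ u : E, gaussianDensity 1 u * Real.exp (‖u‖ ^ 2 / 4)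
      = (2 * Real.pi * 1) ^ (-(Module.finrank ℝ E / 2 : ℝ)) * Real.exp (-4⁻¹ * ‖u‖ ^ 2) := by
    intro u
    simp only [gaussianDensity]
    rw [mul_assoc, ← Real.exp_add]
    ring_nf
  simp_rw [h2]
  rw [integral_const_mul, GaussianFourier.integral_rexp_neg_mul_sq_norm (by norm_num),
    Real.rpow_neg (by positivity), inv_mul_eq_div, ← Real.div_rpow (by positivity) (by positivity)]
  congr 1
  have := Real.pi_pos.ne'
  field_simp
  norm_num

theorem map_orthogonalProjectionOnto_stdGaussian (U : Submodule ℝ E) :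
    (stdGaussian E).map U.orthogonalProjectionOnto = stdGaussian U := by
  have : IsProbabilityMeasure ((stdGaussian E).map U.orthogonalProjectionOnto) :=
    Measure.isProbabilityMeasure_map (by fun_prop)
  refine Measure.ext_of_charFun ?_
  ext t
  rw [charFun_stdGaussian, charFun_apply, integral_map (by fun_prop) (by fun_prop)]
  have : ∀ x : E, inner ℝ (U.orthogonalProjectionOnto x) t = inner ℝ x (t : E) := by
    intro x
    rw [Submodule.coe_inner, Submodule.coe_orthogonalProjectionOnto_apply,
      Submodule.inner_starProjection_left_eq_right, Submodule.starProjection_eq_self_iff.2 t.2]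
  simp_rw [this]
  rw [← charFun_apply, charFun_stdGaussian, Submodule.coe_norm]

theorem integral_comp_starProjection_stdGaussian (U : Submodule ℝ E) {f : ℝ → ℝ}
    (hf : Measurable f) :
    ∫ z, f ‖U.starProjection z‖ ∂(stdGaussian E) = ∫ z : U, f ‖z‖ ∂(stdGaussian U) := by
  rw [← map_orthogonalProjectionOnto_stdGaussian, integral_map (f := fun z : U => f ‖z‖)
    (by fun_prop) (hf.comp measurable_norm).aestronglyMeasurable]
  rfl

theorem integral_inner_stdGaussian (a : E) : ∫ z, inner ℝ a z ∂(stdGaussian E) = 0 :=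
  integral_strongDual_stdGaussian (innerSL ℝ a)

theorem integral_inner_sq_stdGaussian (a : E) :
    ∫ z, inner ℝ a z ^ 2 ∂(stdGaussian E) = ‖a‖ ^ 2 := by
  have h := variance_dual_stdGaussian (E := E) (innerSL ℝ a)
  rw [variance_eq_integral (by fun_prop)] at h
  simpa [integral_inner_stdGaussian] using h

theorem integral_norm_sq_stdGaussian :
    ∫ z : E, ‖z‖ ^ 2 ∂(stdGaussian E) = Module.finrank ℝ E := by
  have h : ∀ z : E, ‖z‖ ^ 2 = ∑ i, inner ℝ (stdOrthonormalBasis ℝ E i) z ^ 2 :=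
    fun z => ((stdOrthonormalBasis ℝ E).sum_sq_inner_right z).symm
  simp_rw [h]
  rw [integral_finsetSum]
  · simp [integral_inner_sq_stdGaussian]
  · intro i _
    refine (integrable_norm_pow_stdGaussian (E := E) 2).mono' (by fun_prop) (ae_of_all _ fun z => ?_)
    have := abs_real_inner_le_norm (stdOrthonormalBasis ℝ E i) z
    rw [OrthonormalBasis.norm_eq_one, one_mul] at this
    rw [Real.norm_eq_abs, abs_pow]
    gcongr

theorem integral_norm_starProjection_sq_stdGaussian (U : Submodule ℝ E) :
    ∫ z, ‖U.starProjection z‖ ^ 2 ∂(stdGaussian E) = Module.finrank ℝ U := by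
  rw [integral_comp_starProjection_stdGaussian U (f := fun x => x ^ 2) (by fun_prop),
    integral_norm_sq_stdGaussian]

theorem integrable_inner_stdGaussian (a : E) :
    Integrable (fun z => inner ℝ a z) (stdGaussian E) :=
  (IsGaussian.integrable_id (μ := stdGaussian E)).const_inner a

/-- A crude constant suffices: `x⁴/4! ≤ exp |x| ≤ exp x + exp (-x)`, and both exponentials have mean
`exp (1/2) ≤ 2`, whence `24 * 4 = 96`. -/
theorem integral_fourth_moment_gaussianReal_le :
    Integrable (fun x : ℝ => x ^ 4) (gaussianReal 0 1) ∧
      ∫ x, x ^ 4 ∂(gaussianReal 0 1) ≤ 96 := by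
  have hi : Integrable (fun x : ℝ => 24 * (Real.exp (1 * x) + Real.exp (-1 * x)))
      (gaussianReal 0 1) :=
    ((integrable_exp_mul_gaussianReal 1).add (integrable_exp_mul_gaussianReal (-1))).const_mul 24
  have hb : ∀ x : ℝ, x ^ 4 ≤ 24 * (Real.exp (1 * x) + Real.exp (-1 * x)) := by
    intro x
    have h := Real.pow_div_factorial_le_exp |x| (abs_nonneg x) 4
    have h4 : |x| ^ 4 = x ^ 4 := Even.pow_abs (by decide) x
    rw [h4] at h
    have h3 : Real.exp |x| ≤ Real.exp (1 * x) + Real.exp (-1 * x) := by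
      rcases abs_cases x with ⟨h, -⟩ | ⟨h, -⟩ <;> rw [h]
      · rw [one_mul]; linarith [Real.exp_pos (-1 * x)]
      · rw [neg_one_mul]; linarith [Real.exp_pos (1 * x)]
    norm_num [Nat.factorial] at h
    linarith
  have hi4 : Integrable (fun x : ℝ => x ^ 4) (gaussianReal 0 1) :=
    hi.mono' (by fun_prop) (ae_of_all _ fun x => by
      rw [Real.norm_eq_abs, abs_of_nonneg (by positivity)]; exact hb x)
  refine ⟨hi4, (integral_mono hi4 hi hb).trans ?_⟩
  have hm : ∀ t : ℝ, ∫ x, Real.exp (t * x) ∂(gaussianReal 0 1) = Real.exp (t ^ 2 / 2) := by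
    intro t
    have := congrFun (mgf_id_gaussianReal (μ := 0) (v := 1)) t
    simpa [mgf] using this
  rw [integral_const_mul, integral_add (integrable_exp_mul_gaussianReal 1)
    (integrable_exp_mul_gaussianReal (-1)), hm, hm]
  have : Real.exp (1 / 2) ≤ 2 := by
    have h1 : Real.exp (1 / 2) ^ 2 = Real.exp 1 := by
      rw [← Real.exp_nat_mul]; norm_num
    nlinarith [Real.exp_one_lt_d9, Real.exp_pos (1 / 2)]
  norm_num at this ⊢
  linarith

/-- `‖z‖²` is a sum of independent squared coordinates, so its variance is linear in the dimension.
This linearity is what keeps the score at order `√n`. -/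
theorem integral_norm_sq_sub_finrank_sq_le :
    ∫ z : E, (‖z‖ ^ 2 - Module.finrank ℝ E) ^ 2 ∂(stdGaussian E) ≤ 96 * Module.finrank ℝ E := by
  have hv : Var[fun z : E => ‖z‖ ^ 2; stdGaussian E]
      = ∫ z : E, (‖z‖ ^ 2 - Module.finrank ℝ E) ^ 2 ∂(stdGaussian E) := by
    rw [variance_eq_integral (by fun_prop), integral_norm_sq_stdGaussian]
  rw [← hv, stdGaussian, variance_map (by fun_prop) (Measurable.aemeasurable (by fun_prop))]
  have hn : (fun z : E => ‖z‖ ^ 2) ∘ (fun x : Fin (Module.finrank ℝ E) → ℝ =>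
      ∑ i, x i • stdOrthonormalBasis ℝ E i) = ∑ i, fun x => x i ^ 2 := by
    ext x
    simp only [Function.comp_apply, Finset.sum_apply]
    rw [← (stdOrthonormalBasis ℝ E).sum_sq_inner_right]
    refine Finset.sum_congr rfl fun i _ => ?_
    rw [(stdOrthonormalBasis ℝ E).orthonormal.inner_right_fintype]
  rw [hn]
  obtain ⟨hi, hle⟩ := integral_fourth_moment_gaussianReal_le
  have hL : MemLp (fun x : ℝ => x ^ 2) 2 (gaussianReal 0 1) := by
    rw [memLp_two_iff_integrable_sq (by fun_prop)]
    refine hi.congr (ae_of_all _ fun x => ?_)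
    ring
  rw [variance_sum_pi (X := fun _ x => x ^ 2) fun _ => hL]
  have h1 : Var[fun x : ℝ => x ^ 2; gaussianReal 0 1] ≤ 96 := by
    refine (variance_le_expectation_sq (by fun_prop)).trans (le_trans (le_of_eq ?_) hle)
    refine integral_congr_ae (ae_of_all _ fun x => ?_)
    simp only [Pi.pow_apply]; ring
  calc _ ≤ ∑ i : Fin (Module.finrank ℝ E), (96 : ℝ) := Finset.sum_le_sum fun i _ => h1
    _ = _ := by simp [mul_comm]

/-- The map is orthogonal on `E × E`, so it preserves the quadratic form in the characteristic
function. It decouples the noise that selects from the noise that validates. -/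
theorem stdGaussian_prod_map_rotation {c s : ℝ} (h : c ^ 2 + s ^ 2 = 1) :
    ((stdGaussian E).prod (stdGaussian E)).map
        (fun p : E × E => (c • p.1 + s • p.2, s • p.1 - c • p.2))
      = (stdGaussian E).prod (stdGaussian E) := by
  let R : E × E →L[ℝ] E × E :=
    (c • ContinuousLinearMap.fst ℝ E E + s • ContinuousLinearMap.snd ℝ E E).prod
      (s • ContinuousLinearMap.fst ℝ E E - c • ContinuousLinearMap.snd ℝ E E)
  change ((stdGaussian E).prod (stdGaussian E)).map R = _
  have : IsProbabilityMeasure (((stdGaussian E).prod (stdGaussian E)).map R) :=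
    Measure.isProbabilityMeasure_map (by fun_prop)
  refine Measure.ext_of_charFunDual ?_
  ext L
  rw [charFunDual_map, charFunDual_prod, charFunDual_prod]
  simp only [charFunDual_stdGaussian]
  set L₁ := L ∘SL ContinuousLinearMap.inl ℝ E E
  set L₂ := L ∘SL ContinuousLinearMap.inr ℝ E E
  have hL : ∀ x y, L (x, y) = L₁ x + L₂ y := by
    intro x y
    have : (x, y) = (x, (0 : E)) + ((0 : E), y) := by simp
    rw [this, map_add]; rfl
  obtain ⟨a, ha⟩ := (InnerProductSpace.toDual ℝ E).surjective L₁
  obtain ⟨b, hb⟩ := (InnerProductSpace.toDual ℝ E).surjective L₂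
  have h1 : (L ∘SL R) ∘SL ContinuousLinearMap.inl ℝ E E
      = InnerProductSpace.toDual ℝ E (c • a + s • b) := by
    ext x
    change L (c • x + s • (0 : E), s • x - c • (0 : E)) = _
    rw [hL]
    simp only [smul_zero, add_zero, sub_zero, map_smul, ← ha, ← hb]
    simp
  have h2 : (L ∘SL R) ∘SL ContinuousLinearMap.inr ℝ E E
      = InnerProductSpace.toDual ℝ E (s • a - c • b) := by
    ext x
    change L (c • (0 : E) + s • x, s • (0 : E) - c • x) = _
    rw [hL]
    simp only [smul_zero, zero_add, zero_sub, map_neg, map_smul, ← ha, ← hb]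
    simp
    ring
  rw [h1, h2, ← ha, ← hb]
  simp only [LinearIsometryEquiv.norm_map]
  rw [← Complex.exp_add, ← Complex.exp_add]
  congr 1
  have key : ‖c • a + s • b‖ ^ 2 + ‖s • a - c • b‖ ^ 2 = ‖a‖ ^ 2 + ‖b‖ ^ 2 := by
    rw [norm_add_sq_real, norm_sub_sq_real]
    simp only [norm_smul, inner_smul_left, inner_smul_right, mul_pow, Real.norm_eq_abs, sq_abs,
      RCLike.conj_to_real]
    linear_combination (‖a‖ ^ 2 + ‖b‖ ^ 2) * h
  have key' : ((‖c • a + s • b‖ : ℂ)) ^ 2 + (‖s • a - c • b‖ : ℂ) ^ 2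
      = (‖a‖ : ℂ) ^ 2 + (‖b‖ : ℂ) ^ 2 := by exact_mod_cast key
  linear_combination (-1 / 2 : ℂ) * key'

theorem integrable_inner_sq_stdGaussian_prod :
    Integrable (fun p : E × E => inner ℝ p.1 p.2 ^ 2) ((stdGaussian E).prod (stdGaussian E)) := by
  refine ((integrable_norm_pow_stdGaussian (E := E) 2).mul_prod
    (integrable_norm_pow_stdGaussian (E := E) 2)).mono' (by fun_prop) (ae_of_all _ fun p => ?_)
  rw [Real.norm_eq_abs, abs_pow, ← mul_pow]
  gcongr
  exact abs_real_inner_le_norm _ _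

theorem integral_inner_sq_stdGaussian_prod :
    ∫ p : E × E, inner ℝ p.1 p.2 ^ 2 ∂((stdGaussian E).prod (stdGaussian E))
      = Module.finrank ℝ E := by
  rw [integral_prod _ integrable_inner_sq_stdGaussian_prod]
  simp_rw [integral_inner_sq_stdGaussian]
  exact integral_norm_sq_stdGaussian

end StandardGaussian

/-! ### Dependence of Gaussian expectations on the variance. -/

section VarianceDerivative

variable {E : Type*} [NormedAddCommGroup E] [InnerProductSpace ℝ E] [FiniteDimensional ℝ E]
  [MeasurableSpace E] [BorelSpace E]

theorem hasDerivAt_gaussianDensity {τ : ℝ} (hτ : 0 < τ) (u : E) :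
    HasDerivAt (fun t => gaussianDensity t u)
      (gaussianDensity τ u * ((‖u‖ ^ 2 / τ - Module.finrank ℝ E) / (2 * τ))) τ := by
  unfold gaussianDensity
  have hpos : (0 : ℝ) < 2 * Real.pi * τ := by positivity
  have h1 : HasDerivAt (fun t : ℝ => 2 * Real.pi * t) (2 * Real.pi) τ := by
    simpa using (hasDerivAt_id τ).const_mul (2 * Real.pi)
  have h2 := h1.rpow_const (p := -(Module.finrank ℝ E / 2 : ℝ)) (Or.inl hpos.ne')
  have h3 : HasDerivAt (fun t : ℝ => 2 * t) 2 τ := by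
    simpa using (hasDerivAt_id τ).const_mul (2 : ℝ)
  have h4 := (((h3.inv (by positivity)).neg).mul_const (‖u‖ ^ 2)).exp
  refine (h2.mul h4).congr_deriv ?_
  rw [Real.rpow_sub_one hpos.ne']
  simp only [Pi.neg_apply, Pi.inv_apply]
  have := Real.pi_pos.ne'
  field_simp
  ring

/-- A dominating function that is uniform near `τ`: the exponential is largest at variance `2τ`, the
normalising constant at `τ/2`, and the two constants differ by the factor `4^(d/2)`. -/
theorem gaussianDensity_le_mul {τ t : ℝ} (hτ : 0 < τ) (ht : t ∈ Set.Ioo (τ / 2) (2 * τ)) (u : E) :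
    gaussianDensity t u ≤ 4 ^ (Module.finrank ℝ E / 2 : ℝ) * gaussianDensity (2 * τ) u := by
  have ht0 : 0 < t := by linarith [ht.1]
  unfold gaussianDensity
  rw [← mul_assoc]
  have h1 : (4 : ℝ) ^ (Module.finrank ℝ E / 2 : ℝ)
      * (2 * Real.pi * (2 * τ)) ^ (-(Module.finrank ℝ E / 2 : ℝ))
      = (Real.pi * τ) ^ (-(Module.finrank ℝ E / 2 : ℝ)) := by
    have : 2 * Real.pi * (2 * τ) = 4 * (Real.pi * τ) := by ring
    rw [this, Real.mul_rpow (by positivity) (by positivity), ← mul_assoc,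
      ← Real.rpow_add (by norm_num), add_neg_cancel, Real.rpow_zero, one_mul]
  rw [h1]
  gcongr ?_ * Real.exp ?_
  · refine Real.rpow_le_rpow_of_nonpos (by positivity) ?_ (by
      rw [neg_nonpos]; positivity)
    nlinarith [Real.pi_pos, ht.1]
  · have : (2 * (2 * τ))⁻¹ ≤ (2 * t)⁻¹ := by
      apply inv_anti₀ (by positivity); linarith [ht.2]
    nlinarith [sq_nonneg ‖u‖]

theorem norm_sqrt_smul_sq {t : ℝ} (ht : 0 ≤ t) (z : E) : ‖√t • z‖ ^ 2 = t * ‖z‖ ^ 2 := by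
  rw [norm_smul, mul_pow, Real.norm_eq_abs, sq_abs, Real.sq_sqrt ht]

theorem integrable_of_growth {f : E → ℝ} (hf : Measurable f) {A : ℝ}
    (hA : ∀ u, |f u| ≤ A + ‖u‖ ^ 2) (t : ℝ) (k : ℕ) :
    Integrable (fun z => |f (t • z)| ^ k) (stdGaussian E) := by
  have hm : MemLp (fun z : E => A + (t ^ 2) * ‖z‖ ^ 2) k (stdGaussian E) := by
    refine (memLp_const A).add (MemLp.const_mul ?_ _)
    rcases Nat.eq_zero_or_pos k with rfl | hk
    · simpa using (by fun_prop : AEStronglyMeasurable (fun z : E => ‖z‖ ^ 2) (stdGaussian E))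
    · rw [← integrable_norm_rpow_iff (by fun_prop) (by exact_mod_cast hk.ne') (by simp)]
      refine (integrable_norm_pow_stdGaussian (E := E) (2 * k)).congr (ae_of_all _ fun z => ?_)
      simp [pow_mul]
  have h := hm.integrable_norm_pow'
  refine h.mono' (((hf.comp (measurable_const_smul t)).norm).pow_const k).aestronglyMeasurable
    (ae_of_all _ fun z => ?_)
  rw [Real.norm_eq_abs, abs_pow, abs_abs]
  gcongr
  refine (hA _).trans (le_trans (le_of_eq ?_) (le_abs_self _))
  rw [norm_smul, mul_pow, Real.norm_eq_abs, sq_abs]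

/-- The integrand jumps where the selected model changes, so `f (√t • z)` need not be differentiable
in `t`. Writing the expectation against the density puts all the `t`-dependence on a smooth factor.
-/
theorem hasDerivAt_integral_comp_sqrt_smul {f : E → ℝ} (hf : Measurable f) {A : ℝ}
    (hA : ∀ u, |f u| ≤ A + ‖u‖ ^ 2) {τ : ℝ} (hτ : 0 < τ) :
    HasDerivAt (fun t => ∫ z, f (√t • z) ∂(stdGaussian E))
      (∫ z, (‖z‖ ^ 2 - Module.finrank ℝ E) / (2 * τ) * f (√τ • z) ∂(stdGaussian E)) τ := by
  have hA0 : 0 ≤ A := by simpa using (abs_nonneg _).trans (hA 0)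
  set d : ℝ := (Module.finrank ℝ E : ℝ) with hd
  have hd0 : 0 ≤ d := by positivity
  have hs : Set.Ioo (τ / 2) (2 * τ) ∈ 𝓝 τ := Ioo_mem_nhds (by linarith) (by linarith)
  let F : ℝ → E → ℝ := fun t u => gaussianDensity t u * f u
  let F' : ℝ → E → ℝ := fun t u => gaussianDensity t u * ((‖u‖ ^ 2 / t - d) / (2 * t) * f u)
  let g : E → ℝ := fun u => (‖u‖ ^ 2 / (τ / 2) + d) / τ * (A + ‖u‖ ^ 2)
  have hcont := fun t => continuous_gaussianDensity (E := E) t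
  have hg : Integrable (fun u => gaussianDensity (2 * τ) u * g u) := by
    rw [integrable_gaussianDensity_mul_iff (by positivity) (by fun_prop)]
    have h2 := integrable_norm_pow_stdGaussian (E := E) 2
    have h4 := integrable_norm_pow_stdGaussian (E := E) 4
    refine (((h4.const_mul ((2 * τ) ^ 2 * 2 / τ ^ 2)).add
      (h2.const_mul ((2 * τ) * (2 * A / τ ^ 2 + d / τ)))).add
        (integrable_const (A * d / τ))).congr (ae_of_all _ fun z => ?_)
    simp only [g, Pi.add_apply]
    rw [norm_sqrt_smul_sq (by positivity)]
    field_simp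
    ring
  have hderiv := hasDerivAt_integral_of_dominated_loc_of_deriv_le (μ := (volume : Measure E))
    (F := F) (F' := F') (bound := fun u => 4 ^ (d / 2) * (gaussianDensity (2 * τ) u * g u)) hs
    (Eventually.of_forall fun t => by
      have := hcont t
      exact (this.measurable.mul hf).aestronglyMeasurable)
    (by
      rw [integrable_gaussianDensity_mul_iff hτ hf]
      have := integrable_of_growth hf hA √τ 1
      simp only [pow_one] at this
      exact (integrable_norm_iff
        (hf.comp (measurable_const_smul √τ)).aestronglyMeasurable).1 this)
    ((hcont τ).measurable.mul (by fun_prop)).aestronglyMeasurable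
    (ae_of_all _ fun u t ht => by
      have ht0 : 0 < t := by linarith [ht.1]
      simp only [F', norm_mul, Real.norm_eq_abs, abs_of_nonneg (gaussianDensity_nonneg ht0 u)]
      rw [← mul_assoc (4 ^ (d / 2))]
      refine mul_le_mul (gaussianDensity_le_mul hτ ht u) ?_ (by positivity)
        (mul_nonneg (by positivity) (gaussianDensity_nonneg (by positivity) u))
      refine mul_le_mul ?_ (hA u) (abs_nonneg _) (by positivity)
      rw [abs_div, abs_of_pos (by positivity : 0 < 2 * t)]
      have h1 : |‖u‖ ^ 2 / t - d| ≤ ‖u‖ ^ 2 / (τ / 2) + d := by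
        refine (abs_sub _ _).trans ?_
        rw [abs_of_nonneg hd0, abs_of_nonneg (by positivity)]
        gcongr
        exact ht.1.le
      refine div_le_div₀ (by positivity) h1 hτ (by linarith [ht.1]))
    (hg.const_mul _)
    (ae_of_all _ fun u t ht => by
      have ht0 : 0 < t := by linarith [ht.1]
      refine ((hasDerivAt_gaussianDensity ht0 u).mul_const (f u)).congr_deriv ?_
      simp only [F']; ring)
  have h := hderiv.2
  have hF' : ∫ u, F' τ u
      = ∫ z, (‖z‖ ^ 2 - d) / (2 * τ) * f (√τ • z) ∂(stdGaussian E) := by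
    rw [← integral_comp_smul_stdGaussian hτ (f := fun u => (‖u‖ ^ 2 / τ - d) / (2 * τ) * f u)
      (by fun_prop)]
    refine integral_congr_ae (ae_of_all _ fun z => ?_)
    simp only
    rw [norm_sqrt_smul_sq hτ.le]
    field_simp
  rw [hF'] at h
  refine h.congr_of_eventuallyEq ?_
  filter_upwards [lt_mem_nhds hτ] with t ht
  exact integral_comp_smul_stdGaussian ht hf

theorem integrable_norm_sq_sub_finrank_sq :
    Integrable (fun z : E => (‖z‖ ^ 2 - Module.finrank ℝ E) ^ 2) (stdGaussian E) := by
  refine (((integrable_norm_pow_stdGaussian (E := E) 4).sub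
    ((integrable_norm_pow_stdGaussian (E := E) 2).const_mul (2 * Module.finrank ℝ E))).add
    (integrable_const ((Module.finrank ℝ E : ℝ) ^ 2))).congr (ae_of_all _ fun z => ?_)
  simp only [Pi.add_apply, Pi.sub_apply]; ring

/-- Gaussian expectations depend on the variance in a Lipschitz way, with a constant governed by
the second moment of the integrand and by the Fisher information of the scale family. -/
theorem abs_integral_comp_sqrt_smul_sub_le {f : E → ℝ} (hf : Measurable f) {A : ℝ}
    (hA : ∀ u, |f u| ≤ A + ‖u‖ ^ 2) {a b D : ℝ} (ha : 0 < a) (hab : a ≤ b)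
    (hD : ∀ τ ∈ Set.Icc a b, ∫ z, f (√τ • z) ^ 2 ∂(stdGaussian E) ≤ D) :
    |(∫ z, f (√b • z) ∂(stdGaussian E)) - ∫ z, f (√a • z) ∂(stdGaussian E)|
      ≤ (D + 24 * Module.finrank ℝ E / a ^ 2) / 2 * (b - a) := by
  have h := norm_image_sub_le_of_norm_deriv_le_segment'
    (f := fun t => ∫ z, f (√t • z) ∂(stdGaussian E))
    (f' := fun τ => ∫ z, (‖z‖ ^ 2 - Module.finrank ℝ E) / (2 * τ) * f (√τ • z) ∂(stdGaussian E))
    (C := (D + 24 * Module.finrank ℝ E / a ^ 2) / 2) (a := a) (b := b)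
    (fun τ hτ => (hasDerivAt_integral_comp_sqrt_smul hf hA
      (ha.trans_le hτ.1)).hasDerivWithinAt) ?_ b (Set.right_mem_Icc.2 hab)
  · simpa [Real.norm_eq_abs] using h
  intro τ hτ
  have hτ0 : 0 < τ := ha.trans_le hτ.1
  have h1 : Integrable (fun z => f (√τ • z) ^ 2) (stdGaussian E) := by
    simpa using integrable_of_growth hf hA √τ 2
  have h2 := (integrable_norm_sq_sub_finrank_sq (E := E)).const_mul ((2 * τ) ^ 2)⁻¹
  -- The derivative is bounded by `|xy| ≤ (x² + y²)/2` with `x` the score and `y` the value of `f`.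
  -- The score has second moment at most `96 d / (2a)² = 24 d / a²`.
  refine (norm_integral_le_of_norm_le ((h1.add h2).div_const 2) (ae_of_all _ fun z => ?_)).trans ?_
  · rw [Real.norm_eq_abs, abs_le]
    simp only [Pi.add_apply]
    have h3 : ((2 * τ) ^ 2)⁻¹ * (‖z‖ ^ 2 - Module.finrank ℝ E) ^ 2
        = ((‖z‖ ^ 2 - Module.finrank ℝ E) / (2 * τ)) ^ 2 := by rw [div_pow]; ring
    rw [h3]
    constructor <;>
      nlinarith [sq_nonneg ((‖z‖ ^ 2 - Module.finrank ℝ E) / (2 * τ) - f (√τ • z)),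
        sq_nonneg ((‖z‖ ^ 2 - Module.finrank ℝ E) / (2 * τ) + f (√τ • z))]
  · rw [integral_div]
    simp only [Pi.add_apply]
    rw [integral_add h1 h2, integral_const_mul]
    gcongr
    · exact hD τ ⟨hτ.1, hτ.2.le⟩
    · calc _ ≤ ((2 * a) ^ 2)⁻¹ * (96 * Module.finrank ℝ E : ℝ) := by
            have := integral_norm_sq_sub_finrank_sq_le (E := E)
            have := hτ.1
            gcongr
        _ = _ := by field_simp; ring

end VarianceDerivative

/-! ### A maximal inequality for finitely many projections. -/

section Envelope

variable {E : Type*} [NormedAddCommGroup E] [InnerProductSpace ℝ E] [FiniteDimensional ℝ E]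
  [MeasurableSpace E] [BorelSpace E] {ι : Type*} [Fintype ι]

/-- A smooth upper bound for `maxᵢ ‖Vᵢ z‖⁴`, the maximum being over a finite family of
orthogonal projections. -/
noncomputable def projEnvelope (V : ι → Submodule ℝ E) (l : ℝ) (z : E) : ℝ :=
  2 * l ^ 2 + 64 * Real.exp (-l / 4) * ∑ i, Real.exp (‖(V i).starProjection z‖ ^ 2 / 4)

theorem norm_starProjection_pow_four_le_projEnvelope (V : ι → Submodule ℝ E) {l : ℝ} (hl : 0 ≤ l)
    (i : ι) (z : E) : ‖(V i).starProjection z‖ ^ 4 ≤ projEnvelope V l z := by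
  unfold projEnvelope
  set x := ‖(V i).starProjection z‖ ^ 2 with hx
  have hx0 : 0 ≤ x := by positivity
  have h1 : Real.exp (x / 4) ≤ ∑ j, Real.exp (‖(V j).starProjection z‖ ^ 2 / 4) :=
    Finset.single_le_sum (f := fun j => Real.exp (‖(V j).starProjection z‖ ^ 2 / 4))
      (fun j _ => (Real.exp_pos _).le) (Finset.mem_univ i)
  have h2 : Real.exp (-l / 4) * Real.exp (x / 4)
      ≤ Real.exp (-l / 4) * ∑ j, Real.exp (‖(V j).starProjection z‖ ^ 2 / 4) := by gcongr
  rw [← Real.exp_add] at h2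
  have h3 : ‖(V i).starProjection z‖ ^ 4 = x ^ 2 := by rw [hx]; ring
  rw [h3]
  suffices x ^ 2 ≤ 2 * l ^ 2 + 64 * Real.exp (-l / 4 + x / 4) by linarith
  -- Above the threshold, `x² ≤ 2l² + 2(x-l)²`, and with `t = (x-l)/4` the last term is `32 t² ≤ 64
  -- exp t`.
  rcases le_total x l with h | h
  · have := Real.exp_pos (-l / 4 + x / 4)
    nlinarith
  · have h5 := Real.quadratic_le_exp_of_nonneg (x := -l / 4 + x / 4) (by linarith)
    nlinarith [sq_nonneg (x - 2 * l)]

theorem integrable_exp_norm_starProjection_sq (V : Submodule ℝ E) :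
    Integrable (fun z => Real.exp (‖V.starProjection z‖ ^ 2 / 4)) (stdGaussian E) := by
  refine (integrable_exp_norm_sq_stdGaussian (E := E)).mono' (by fun_prop) (ae_of_all _ fun z => ?_)
  rw [Real.norm_eq_abs, Real.abs_exp]
  gcongr
  exact V.norm_starProjection_apply_le z

theorem integrable_projEnvelope (V : ι → Submodule ℝ E) (l : ℝ) :
    Integrable (projEnvelope V l) (stdGaussian E) :=
  (integrable_const _).add
    ((integrable_finsetSum _ fun i _ => integrable_exp_norm_starProjection_sq (V i)).const_mul _)

/-- The threshold `l` is chosen so that `exp (l/4)` dominates the number of models times the largest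
exponential moment `2^(m/2)`; the exponential part then contributes at most `64`. -/
theorem integral_projEnvelope_le (V : ι → Submodule ℝ E) {l : ℝ}
    {m : ℕ} (hV : ∀ i, Module.finrank ℝ (V i) ≤ m)
    (hl : 4 * (Real.log (Fintype.card ι) + m / 2 * Real.log 2) ≤ l) :
    ∫ z, projEnvelope V l z ∂(stdGaussian E) ≤ 2 * l ^ 2 + 64 := by
  unfold projEnvelope
  rw [integral_add (integrable_const _) ((integrable_finsetSum _ fun i _ =>
    integrable_exp_norm_starProjection_sq (V i)).const_mul _), integral_const, integral_const_mul,
    integral_finsetSum _ fun i _ => integrable_exp_norm_starProjection_sq (V i)]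
  have h1 : ∀ i, ∫ z, Real.exp (‖(V i).starProjection z‖ ^ 2 / 4) ∂(stdGaussian E)
      ≤ Real.exp (m / 2 * Real.log 2) := by
    intro i
    rw [integral_comp_starProjection_stdGaussian (V i) (f := fun x => Real.exp (x ^ 2 / 4))
      (by fun_prop), integral_exp_norm_sq_stdGaussian, mul_comm, ← Real.rpow_def_of_pos two_pos]
    refine Real.rpow_le_rpow_of_exponent_le one_le_two ?_
    have := hV i
    gcongr
  have h2 : ∑ i, ∫ z, Real.exp (‖(V i).starProjection z‖ ^ 2 / 4) ∂(stdGaussian E)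
      ≤ Real.exp (l / 4) := by
    refine (Finset.sum_le_sum fun i _ => h1 i).trans ?_
    rw [Finset.sum_const, nsmul_eq_mul, Finset.card_univ]
    rcases Nat.eq_zero_or_pos (Fintype.card ι) with h0 | h0
    · rw [h0]; simp; positivity
    · nth_rw 1 [← Real.exp_log (show (0 : ℝ) < Fintype.card ι by exact_mod_cast h0)]
      rw [← Real.exp_add]
      gcongr
      linarith
  have h3 : Real.exp (-l / 4) * Real.exp (l / 4) = 1 := by
    rw [← Real.exp_add]; simp [neg_div]
  have h4 := mul_le_mul_of_nonneg_left h2 (Real.exp_pos (-l / 4)).le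
  simp only [probReal_univ, one_smul]
  linarith

end Envelope

/-! ### Algebra of orthogonal projections and residuals. -/

section ProjectionModel

variable {E : Type*} [NormedAddCommGroup E] [InnerProductSpace ℝ E] [FiniteDimensional ℝ E]
  {ι : Type*}

/-- The part of the mean that the model `U` misses. -/
noncomputable def missed (U : Submodule ℝ E) (μ : E) : E := μ - U.starProjection μ

theorem inner_missed_starProjection (U : Submodule ℝ E) (μ x : E) :
    inner ℝ (missed U μ) (U.starProjection x) = 0 := by
  rw [missed, ← U.inner_starProjection_left_eq_right, map_sub,
    U.starProjection_eq_self_iff.2 (U.starProjection_apply_mem μ), sub_self, inner_zero_left]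

theorem inner_starProjection_eq (U : Submodule ℝ E) (x y : E) :
    inner ℝ (U.starProjection x) y = inner ℝ (U.starProjection x) (U.starProjection y) := by
  rw [← U.inner_starProjection_left_eq_right,
    U.starProjection_eq_self_iff.2 (U.starProjection_apply_mem x)]

theorem inner_starProjection_self (U : Submodule ℝ E) (x : E) :
    inner ℝ (U.starProjection x) x = ‖U.starProjection x‖ ^ 2 := by
  rw [inner_starProjection_eq, real_inner_self_eq_norm_sq]

theorem norm_missed_sq_le (U : Submodule ℝ E) (μ : E) : ‖missed U μ‖ ^ 2 ≤ ‖μ‖ ^ 2 := by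
  have h : ‖missed U μ‖ ^ 2 = ‖μ‖ ^ 2 - ‖U.starProjection μ‖ ^ 2 := by
    rw [missed, norm_sub_sq_real, real_inner_comm, inner_starProjection_self]; ring
  rw [h]; nlinarith [sq_nonneg ‖U.starProjection μ‖]

/-- The prediction error estimator at `x = (y, ω)` when the models are subspaces. -/
noncomputable def modelErr (σ : ℝ) (U : ι → Submodule ℝ E) (S : E → ι) (α : ℝ) (x : E × E) : ℝ :=
  ‖(x.1 - α⁻¹ • x.2) - (U (S (x.1 + x.2))).starProjection x.1‖ ^ 2
    + 2 * (Module.finrank ℝ (U (S (x.1 + x.2))) : ℝ) * σ ^ 2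
    - α⁻¹ * (Module.finrank ℝ E : ℝ) * σ ^ 2

/-- The loss at `x = (y, y_new)` when the models are subspaces. -/
noncomputable def modelLoss (U : ι → Submodule ℝ E) (S : E → ι) (x : E × E) : ℝ :=
  ‖x.2 - (U (S x.1)).starProjection x.1‖ ^ 2

theorem norm_residual_sq (U : Submodule ℝ E) (μ z w : E) (σ κ : ℝ) :
    ‖missed U μ + σ • (z - U.starProjection z) - κ • w‖ ^ 2
      = ‖missed U μ‖ ^ 2 + σ ^ 2 * (‖z‖ ^ 2 - ‖U.starProjection z‖ ^ 2) + κ ^ 2 * ‖w‖ ^ 2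
        + 2 * σ * inner ℝ (missed U μ) z - 2 * κ * inner ℝ (missed U μ) w
        - 2 * σ * κ * (inner ℝ z w - inner ℝ (U.starProjection z) (U.starProjection w)) := by
  rw [norm_sub_sq_real, norm_add_sq_real]
  simp only [inner_add_left, inner_sub_left, inner_sub_right, inner_smul_left, inner_smul_right,
    norm_smul, mul_pow, Real.norm_eq_abs, sq_abs, RCLike.conj_to_real,
    inner_missed_starProjection, inner_starProjection_eq U z w]
  rw [norm_sub_sq_real, real_inner_comm (U.starProjection z) z, inner_starProjection_self]
  ring

theorem norm_rotated_residual_sq (U : Submodule ℝ E) (μ a b : E) (k l m : ℝ) :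
    ‖missed U μ + k • b - l • U.starProjection a - m • U.starProjection b‖ ^ 2
      = ‖missed U μ‖ ^ 2 + l ^ 2 * ‖U.starProjection a‖ ^ 2 + k ^ 2 * ‖b‖ ^ 2
        + (m ^ 2 - 2 * k * m) * ‖U.starProjection b‖ ^ 2
        + 2 * k * inner ℝ (missed U μ) b
        + (2 * l * m - 2 * k * l) * inner ℝ (U.starProjection a) b := by
  rw [norm_sub_sq_real, norm_sub_sq_real, norm_add_sq_real]
  simp only [inner_add_left, inner_sub_left, inner_smul_left, inner_smul_right,
    norm_smul, mul_pow, Real.norm_eq_abs, sq_abs, RCLike.conj_to_real,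
    inner_missed_starProjection]
  rw [← inner_starProjection_eq U a b, real_inner_comm (U.starProjection a) b,
    real_inner_comm (U.starProjection b) b, inner_starProjection_self]
  ring

theorem measurable_select {X : Type*} [MeasurableSpace X] [Countable ι] [MeasurableSpace ι]
    [DiscreteMeasurableSpace ι] {F : ι → X → ℝ} (hF : ∀ i, Measurable (F i)) {T : X → ι}
    (hT : Measurable T) : Measurable fun x => F (T x) x := by
  have h : Measurable fun p : ι × X => F p.1 p.2 := measurable_from_prod_countable_right hF
  exact h.comp (hT.prodMk measurable_id)

theorem norm_starProjection_le_of_le {U V : Submodule ℝ E} (h : U ≤ V) (z : E) :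
    ‖U.starProjection z‖ ≤ ‖V.starProjection z‖ := by
  have h1 : U.starProjection z = U.starProjection (V.starProjection z) := by
    have := Submodule.starProjection_comp_starProjection_of_le h
    exact (congrArg (fun f => f z) this).symm
  rw [h1]
  exact U.norm_starProjection_apply_le _

theorem norm_starProjection_pow_four_le {U V : Submodule ℝ E} (h : U ≤ V) (z : E) :
    ‖U.starProjection z‖ ^ 4 ≤ ‖V.starProjection z‖ ^ 4 := by
  gcongr
  exact norm_starProjection_le_of_le h z

/-- Only the component of `z` in `V` meets `v`. Enlarging a model by its missed mean thus lets one
envelope control this inner product too. -/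
theorem two_mul_inner_sq_le_of_mem {V : Submodule ℝ E} {v : E} (hv : v ∈ V) (z : E) :
    2 * inner ℝ v z ^ 2 ≤ ‖v‖ ^ 4 + ‖V.starProjection z‖ ^ 4 := by
  have h1 : inner ℝ v z = inner ℝ v (V.starProjection z) := by
    rw [← V.inner_starProjection_left_eq_right, V.starProjection_eq_self_iff.2 hv]
  have h2 := abs_real_inner_le_norm v (V.starProjection z)
  rw [← h1] at h2
  have h3 : inner ℝ v z ^ 2 ≤ (‖v‖ * ‖V.starProjection z‖) ^ 2 := by
    rw [← sq_abs]; gcongr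
  nlinarith [sq_nonneg (‖v‖ ^ 2 - ‖V.starProjection z‖ ^ 2)]

end ProjectionModel

/-! ### Second moment of the estimator. -/

section ModelMoments

variable {E : Type*} [NormedAddCommGroup E] [InnerProductSpace ℝ E] [FiniteDimensional ℝ E]
  [MeasurableSpace E] [BorelSpace E]
  {ι : Type*} [Fintype ι] [MeasurableSpace ι] [DiscreteMeasurableSpace ι]
  {U : ι → Submodule ℝ E} {μ : E} {Q : E → ℝ}

/-- The pair `(y, ω)` written in terms of two standard Gaussian vectors. -/
noncomputable def gaussianPair (μ : E) (s t : ℝ) (x : E × E) : E × E := (μ + s • x.1, t • x.2)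

theorem measurable_gaussianPair (μ : E) (s t : ℝ) : Measurable (gaussianPair μ s t) := by
  unfold gaussianPair; fun_prop

theorem measurable_modelErr (σ : ℝ) (U : ι → Submodule ℝ E) {S : E → ι} (hS : Measurable S)
    (α : ℝ) : Measurable (modelErr σ U S α) := by
  refine measurable_select (F := fun i x => ‖(x.1 - α⁻¹ • x.2) - (U i).starProjection x.1‖ ^ 2
    + 2 * (Module.finrank ℝ (U i) : ℝ) * σ ^ 2 - α⁻¹ * (Module.finrank ℝ E : ℝ) * σ ^ 2)
    (fun i => ?_) (T := fun x : E × E => S (x.1 + x.2)) (by fun_prop)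
  fun_prop

theorem measurable_modelLoss (U : ι → Submodule ℝ E) {S : E → ι} (hS : Measurable S) :
    Measurable (modelLoss U S) := by
  refine measurable_select (F := fun i x => ‖x.2 - (U i).starProjection x.1‖ ^ 2)
    (fun i => ?_) (T := fun x : E × E => S x.1) (by fun_prop)
  fun_prop

/-- The rank is the mean of `‖P z‖²`, so by Jensen its square is at most the mean of `‖P z‖⁴`. The
envelope therefore controls the ranks as well. -/
theorem finrank_sq_le_integral (hQ : Integrable Q (stdGaussian E))
    (hP : ∀ i z, ‖(U i).starProjection z‖ ^ 4 ≤ Q z) (i : ι) :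
    (Module.finrank ℝ (U i) : ℝ) ^ 2 ≤ ∫ z, Q z ∂(stdGaussian E) := by
  rw [← integral_norm_starProjection_sq_stdGaussian]
  have hi : Integrable (fun z => ‖(U i).starProjection z‖ ^ 4) (stdGaussian E) :=
    hQ.mono' (by fun_prop) (ae_of_all _ fun z => by
      rw [Real.norm_eq_abs, abs_of_nonneg (by positivity)]; exact hP i z)
  have hm : MemLp (fun z => ‖(U i).starProjection z‖ ^ 2) 2 (stdGaussian E) := by
    rw [memLp_two_iff_integrable_sq (by fun_prop)]
    refine hi.congr (ae_of_all _ fun z => ?_)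
    ring
  have h := variance_nonneg (fun z => ‖(U i).starProjection z‖ ^ 2) (stdGaussian E)
  rw [variance_eq_sub hm] at h
  have h2 : ∫ z, ((fun z => ‖(U i).starProjection z‖ ^ 2) ^ 2) z ∂(stdGaussian E) ≤ ∫ z, Q z ∂(stdGaussian E) := by
    refine integral_mono_of_nonneg (ae_of_all _ fun z => ?_) hQ (ae_of_all _ fun z => ?_)
    · simp only [Pi.pow_apply, Pi.zero_apply]; positivity
    · refine le_trans (le_of_eq ?_) (hP i z)
      simp only [Pi.pow_apply]; ring
  linarith

/-- The vector `(z + √α w) / √(1 + α)` is standard Gaussian. -/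
theorem map_add_smul_stdGaussian_prod {α : ℝ} (hα : 0 < α) :
    (stdGaussian E |>.prod (stdGaussian E)).map
      (fun p : E × E => (√(1 + α))⁻¹ • p.1 + (√α / √(1 + α)) • p.2) = stdGaussian E := by
  have h : ((√(1 + α))⁻¹) ^ 2 + (√α / √(1 + α)) ^ 2 = 1 := by
    rw [inv_pow, div_pow, Real.sq_sqrt (by linarith), Real.sq_sqrt hα.le]; field_simp
  have h1 := stdGaussian_prod_map_rotation (E := E) h
  have h2 := congrArg (Measure.map Prod.fst) h1
  rw [Measure.map_map measurable_fst (by fun_prop), Measure.map_fst_prod] at h2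
  simpa [Function.comp_def] using h2

theorem sum_nine_sq_le (a b c d e f g h i : ℝ) :
    (a + b + c + d + e + f + g + h + i) ^ 2
      ≤ 9 * (a ^ 2 + b ^ 2 + c ^ 2 + d ^ 2 + e ^ 2 + f ^ 2 + g ^ 2 + h ^ 2 + i ^ 2) := by
  have := sq_sum_le_card_mul_sum_sq (s := Finset.univ) (f := ![a, b, c, d, e, f, g, h, i])
  simpa [Fin.sum_univ_succ, add_assoc] using this

/-- The scale `κ = σ/√α` is that of `ω/α`. The correction `-nσ²/α` centres `κ²‖w‖²`, and subtracting
`σ² d` centres `σ²‖z‖²`. Since the model depends on both `z` and `w`, every term containing its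
projection or its missed mean is bounded pathwise, by quantities free of the selection except for
the missed mean itself. -/
theorem modelErr_sub_sq_le {q : ℝ} {S : E → ι}
    (hP : ∀ i z, ‖(U i).starProjection z‖ ^ 4 ≤ Q z)
    (hv : ∀ i z, 2 * inner ℝ (missed (U i) μ) z ^ 2 ≤ ‖missed (U i) μ‖ ^ 4 + Q z)
    (hq : ∀ i, (Module.finrank ℝ (U i) : ℝ) ^ 2 ≤ q) {σ α κ : ℝ} (hα : 0 < α)
    (hκ : κ ^ 2 = σ ^ 2 / α) (x : E × E) :
    (modelErr σ U S α (gaussianPair μ σ (α * κ) x) - σ ^ 2 * Module.finrank ℝ E) ^ 2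
      ≤ 9 * ((1 + 2 * σ ^ 2 + 2 * κ ^ 2) *
            ‖missed (U (S (μ + σ • x.1 + (α * κ) • x.2))) μ‖ ^ 4
          + σ ^ 4 * (‖x.1‖ ^ 2 - Module.finrank ℝ E) ^ 2
          + κ ^ 4 * (‖x.2‖ ^ 2 - Module.finrank ℝ E) ^ 2
          + (σ ^ 4 + 2 * σ ^ 2 + 2 * σ ^ 2 * κ ^ 2) * Q x.1
          + (2 * κ ^ 2 + 2 * σ ^ 2 * κ ^ 2) * Q x.2
          + 4 * σ ^ 2 * κ ^ 2 * inner ℝ x.1 x.2 ^ 2 + 4 * σ ^ 4 * q) := by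
  obtain ⟨z, w⟩ := x
  set i := S (μ + σ • z + (α * κ) • w)
  set P := (U i).starProjection
  set d : ℝ := (Module.finrank ℝ E : ℝ)
  set r : ℝ := (Module.finrank ℝ (U i) : ℝ)
  have hdef : modelErr σ U S α (gaussianPair μ σ (α * κ) (z, w))
      = ‖μ + σ • z - α⁻¹ • ((α * κ) • w) - P (μ + σ • z)‖ ^ 2 + 2 * r * σ ^ 2
        - α⁻¹ * d * σ ^ 2 := rfl
  have hres : μ + σ • z - α⁻¹ • ((α * κ) • w) - P (μ + σ • z)
      = missed (U i) μ + σ • (z - P z) - κ • w := by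
    rw [smul_smul, inv_mul_cancel_left₀ hα.ne', map_add, map_smul, missed, smul_sub]
    abel
  rw [hdef, hres, norm_residual_sq]
  set v := missed (U i) μ
  have hid : ‖v‖ ^ 2 + σ ^ 2 * (‖z‖ ^ 2 - ‖P z‖ ^ 2) + κ ^ 2 * ‖w‖ ^ 2 + 2 * σ * inner ℝ v z
        - 2 * κ * inner ℝ v w - 2 * σ * κ * (inner ℝ z w - inner ℝ (P z) (P w))
        + 2 * r * σ ^ 2 - α⁻¹ * d * σ ^ 2 - σ ^ 2 * d
      = ‖v‖ ^ 2 + σ ^ 2 * (‖z‖ ^ 2 - d) + -(σ ^ 2 * ‖P z‖ ^ 2) + κ ^ 2 * (‖w‖ ^ 2 - d)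
        + 2 * σ * inner ℝ v z + -(2 * κ * inner ℝ v w) + -(2 * σ * κ * inner ℝ z w)
        + 2 * σ * κ * inner ℝ (P z) (P w) + 2 * r * σ ^ 2 := by
    rw [hκ]; field_simp; ring
  rw [hid]
  refine (sum_nine_sq_le _ _ _ _ _ _ _ _ _).trans ?_
  have e1 := hP i z
  have e2 := hP i w
  have e3 := hv i z
  have e4 := hv i w
  have e5 := hq i
  have e6 : inner ℝ (P z) (P w) ^ 2 ≤ (Q z + Q w) / 2 := by
    have h := abs_real_inner_le_norm (P z) (P w)
    have h' : inner ℝ (P z) (P w) ^ 2 ≤ (‖P z‖ * ‖P w‖) ^ 2 := by rw [← sq_abs]; gcongr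
    nlinarith [sq_nonneg (‖P z‖ ^ 2 - ‖P w‖ ^ 2)]
  have f1 := mul_le_mul_of_nonneg_left e1 (by positivity : 0 ≤ σ ^ 4)
  have f3 := mul_le_mul_of_nonneg_left e3 (by positivity : 0 ≤ 2 * σ ^ 2)
  have f4 := mul_le_mul_of_nonneg_left e4 (by positivity : 0 ≤ 2 * κ ^ 2)
  have f5 := mul_le_mul_of_nonneg_left e5 (by positivity : 0 ≤ 4 * σ ^ 4)
  have f6 := mul_le_mul_of_nonneg_left e6 (by positivity : 0 ≤ 4 * σ ^ 2 * κ ^ 2)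
  linarith

theorem integrable_missed_comp {X : Type*} [MeasurableSpace X] (ρ : Measure X) [IsFiniteMeasure ρ]
    (U : ι → Submodule ℝ E) (μ : E) (k : ℕ) {T : X → ι} (hT : Measurable T) :
    Integrable (fun x => ‖missed (U (T x)) μ‖ ^ k) ρ := by
  refine Integrable.of_bound (C := ‖μ‖ ^ k) (Measurable.aestronglyMeasurable
    (measurable_select (F := fun i _ => ‖missed (U i) μ‖ ^ k) (fun _ => measurable_const) hT))
    (ae_of_all _ fun x => ?_)
  rw [norm_pow, norm_norm]
  gcongr
  exact le_of_sq_le_sq (norm_missed_sq_le _ μ) (norm_nonneg _)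

/-- The selection sees only `y*`, which is Gaussian with variance `(1+α)σ²`; the accuracy assumption
applies at that variance. -/
theorem integral_missed_pow_four_prod {S : E → ι} (hS : Measurable S) {σ α κ : ℝ} (hσ : 0 < σ)
    (hα : 0 < α) (hκ : κ = σ / √α) :
    ∫ x : E × E, ‖missed (U (S (μ + σ • x.1 + (α * κ) • x.2))) μ‖ ^ 4 ∂((stdGaussian E).prod (stdGaussian E))
      = ∫ z, ‖missed (U (S (μ + √((1 + α) * σ ^ 2) • z))) μ‖ ^ 4 ∂(stdGaussian E) := by
  have hm : Measurable fun z : E => ‖missed (U (S (μ + √((1 + α) * σ ^ 2) • z))) μ‖ ^ 4 :=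
    measurable_select (F := fun i _ => ‖missed (U i) μ‖ ^ 4) (fun _ => measurable_const)
      (T := fun z : E => S (μ + √((1 + α) * σ ^ 2) • z)) (by fun_prop)
  conv_rhs => rw [← map_add_smul_stdGaussian_prod (E := E) hα]
  rw [integral_map (by fun_prop) hm.aestronglyMeasurable]
  refine integral_congr_ae (ae_of_all _ fun x => ?_)
  simp only
  have h1 : 0 < √(1 + α) := Real.sqrt_pos.2 (by linarith)
  have h2 : √((1 + α) * σ ^ 2) = √(1 + α) * σ := by
    rw [Real.sqrt_mul (by linarith), Real.sqrt_sq hσ.le]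
  have h3 : α * κ = √α * σ := by
    rw [hκ]; nth_rw 1 [← Real.mul_self_sqrt hα.le]
    have := (Real.sqrt_pos.2 hα).ne'
    field_simp
  rw [h2, h3, smul_add, smul_smul, smul_smul, add_assoc]
  congr 7
  · field_simp
  · field_simp

/-- Second moment of the error estimator around the noise level. -/
theorem modelErr_second_moment {S : E → ι} (hS : Measurable S) (hQ : Integrable Q (stdGaussian E))
    (hP : ∀ i z, ‖(U i).starProjection z‖ ^ 4 ≤ Q z)
    (hv : ∀ i z, 2 * inner ℝ (missed (U i) μ) z ^ 2 ≤ ‖missed (U i) μ‖ ^ 4 + Q z)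
    {σ α A q : ℝ} (hσ : 0 < σ) (hα : 0 < α) (hq : ∫ z, Q z ∂(stdGaussian E) ≤ q)
    (hA : ∫ z, ‖missed (U (S (μ + √((1 + α) * σ ^ 2) • z))) μ‖ ^ 4 ∂(stdGaussian E) ≤ A) :
    Integrable (fun x => (modelErr σ U S α (gaussianPair μ σ (√(α * σ ^ 2)) x)
        - σ ^ 2 * Module.finrank ℝ E) ^ 2) ((stdGaussian E).prod (stdGaussian E)) ∧
      ∫ x, (modelErr σ U S α (gaussianPair μ σ (√(α * σ ^ 2)) x)
        - σ ^ 2 * Module.finrank ℝ E) ^ 2 ∂((stdGaussian E).prod (stdGaussian E))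
      ≤ 9 * ((1 + 2 * σ ^ 2 + 2 * (σ ^ 2 / α)) * A
          + (96 * (σ ^ 4 + (σ ^ 2 / α) ^ 2) + 4 * σ ^ 2 * (σ ^ 2 / α)) * Module.finrank ℝ E
          + (5 * σ ^ 4 + 2 * σ ^ 2 + 2 * (σ ^ 2 / α) + 4 * σ ^ 2 * (σ ^ 2 / α)) * q) := by
  set κ : ℝ := σ / √α with hκ
  have hκ2 : κ ^ 2 = σ ^ 2 / α := by rw [hκ, div_pow, Real.sq_sqrt hα.le]
  have hακ : √(α * σ ^ 2) = α * κ := by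
    rw [Real.sqrt_mul hα.le, Real.sqrt_sq hσ.le, hκ]
    nth_rw 2 [← Real.mul_self_sqrt hα.le]
    have := (Real.sqrt_pos.2 hα).ne'
    field_simp
  rw [hακ, ← hκ2]
  set d : ℝ := (Module.finrank ℝ E : ℝ)
  have hr : ∀ i, (Module.finrank ℝ (U i) : ℝ) ^ 2 ≤ q :=
    fun i => (finrank_sq_le_integral hQ hP i).trans hq
  have hle := modelErr_sub_sq_le (S := S) hP hv hr (σ := σ) hα hκ2
  have iV : Integrable (fun x : E × E => ‖missed (U (S (μ + σ • x.1 + (α * κ) • x.2))) μ‖ ^ 4)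
      ((stdGaussian E).prod (stdGaussian E)) := integrable_missed_comp _ U μ 4 (by fun_prop)
  have iX : Integrable (fun z : E => (‖z‖ ^ 2 - d) ^ 2) (stdGaussian E) := integrable_norm_sq_sub_finrank_sq
  have iI := integrable_inner_sq_stdGaussian_prod (E := E)
  have hX : ∫ z : E, (‖z‖ ^ 2 - d) ^ 2 ∂(stdGaussian E) ≤ 96 * d := integral_norm_sq_sub_finrank_sq_le
  have hI := integral_inner_sq_stdGaussian_prod (E := E)
  have hV := integral_missed_pow_four_prod (U := U) (μ := μ) hS hσ hα hκ
  have j1 := iV.const_mul (1 + 2 * σ ^ 2 + 2 * κ ^ 2)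
  have j2 := (iX.comp_fst (stdGaussian E)).const_mul (σ ^ 4)
  have j3 := (iX.comp_snd (stdGaussian E)).const_mul (κ ^ 4)
  have j4 := (hQ.comp_fst (stdGaussian E)).const_mul (σ ^ 4 + 2 * σ ^ 2 + 2 * σ ^ 2 * κ ^ 2)
  have j5 := (hQ.comp_snd (stdGaussian E)).const_mul (2 * κ ^ 2 + 2 * σ ^ 2 * κ ^ 2)
  have j6 := iI.const_mul (4 * σ ^ 2 * κ ^ 2)
  have j7 : Integrable (fun _ : E × E => 4 * σ ^ 4 * q) ((stdGaussian E).prod (stdGaussian E)) := integrable_const _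
  have j := ((((((j1.add j2).add j3).add j4).add j5).add j6).add j7).const_mul 9
  have hint : Integrable (fun x => (modelErr σ U S α (gaussianPair μ σ (α * κ) x)
      - σ ^ 2 * d) ^ 2) ((stdGaussian E).prod (stdGaussian E)) := by
    refine j.mono' (Measurable.aestronglyMeasurable ?_) (ae_of_all _ fun x => ?_)
    · exact (((measurable_modelErr σ U hS α).comp (measurable_gaussianPair μ σ (α * κ))).sub_const
        _).pow_const 2
    · rw [Real.norm_eq_abs, abs_of_nonneg (sq_nonneg _)]
      exact hle x
  refine ⟨hint, (integral_mono hint j hle).trans ?_⟩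
  rw [integral_const_mul, integral_add' (((((j1.add j2).add j3).add j4).add j5).add j6) j7,
    integral_add' ((((j1.add j2).add j3).add j4).add j5) j6,
    integral_add' (((j1.add j2).add j3).add j4) j5,
    integral_add' ((j1.add j2).add j3) j4, integral_add' (j1.add j2) j3, integral_add' j1 j2]
  simp only [integral_const_mul, integral_const, probReal_univ, one_smul]
  rw [integral_fun_fst (μ := stdGaussian E) (ν := stdGaussian E) (fun z : E => (‖z‖ ^ 2 - d) ^ 2),
    integral_fun_snd (μ := stdGaussian E) (ν := stdGaussian E) (fun z : E => (‖z‖ ^ 2 - d) ^ 2),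
    integral_fun_fst (μ := stdGaussian E) (ν := stdGaussian E) Q, integral_fun_snd (μ := stdGaussian E) (ν := stdGaussian E) Q, hI, hV]
  simp only [probReal_univ, one_smul]
  have k1 := mul_le_mul_of_nonneg_left hA (by positivity : 0 ≤ 1 + 2 * σ ^ 2 + 2 * κ ^ 2)
  have k2 := mul_le_mul_of_nonneg_left hX (by positivity : 0 ≤ σ ^ 4)
  have k3 := mul_le_mul_of_nonneg_left hX (by positivity : 0 ≤ κ ^ 4)
  have k4 := mul_le_mul_of_nonneg_left hq
    (by positivity : 0 ≤ σ ^ 4 + 2 * σ ^ 2 + 2 * σ ^ 2 * κ ^ 2)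
  have k5 := mul_le_mul_of_nonneg_left hq (by positivity : 0 ≤ 2 * κ ^ 2 + 2 * σ ^ 2 * κ ^ 2)
  linarith

end ModelMoments

/-! ### Bias of the estimator. -/

section ModelBias

variable {E : Type*} [NormedAddCommGroup E] [InnerProductSpace ℝ E] [FiniteDimensional ℝ E]
  [MeasurableSpace E] [BorelSpace E]
  {ι : Type*} [Fintype ι] [MeasurableSpace ι] [DiscreteMeasurableSpace ι]
  {U : ι → Submodule ℝ E} {μ : E} {Q : E → ℝ}

/-- The squared estimation error of the selected fit at `μ + u`. -/
noncomputable def fitRisk (U : ι → Submodule ℝ E) (S : E → ι) (μ u : E) : ℝ :=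
  ‖missed (U (S (μ + u))) μ‖ ^ 2 + ‖(U (S (μ + u))).starProjection u‖ ^ 2

theorem measurable_fitRisk (U : ι → Submodule ℝ E) {S : E → ι} (hS : Measurable S) (μ : E) :
    Measurable (fitRisk U S μ) :=
  measurable_select (F := fun i u => ‖missed (U i) μ‖ ^ 2 + ‖(U i).starProjection u‖ ^ 2)
    (fun i => by fun_prop) (T := fun u : E => S (μ + u)) (by fun_prop)

theorem abs_fitRisk_le (U : ι → Submodule ℝ E) (S : E → ι) (μ u : E) :
    |fitRisk U S μ u| ≤ ‖μ‖ ^ 2 + ‖u‖ ^ 2 := by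
  rw [fitRisk, abs_of_nonneg (by positivity)]
  refine add_le_add (norm_missed_sq_le _ μ) ?_
  gcongr
  exact Submodule.norm_starProjection_apply_le _ u

theorem integrable_fitRisk (U : ι → Submodule ℝ E) {S : E → ι} (hS : Measurable S) (μ : E)
    (t : ℝ) : Integrable (fun z => fitRisk U S μ (t • z)) (stdGaussian E) := by
  have hm := measurable_fitRisk U hS μ
  have h := integrable_of_growth hm (abs_fitRisk_le U S μ) t 1
  simp only [pow_one] at h
  exact (integrable_norm_iff (hm.comp (measurable_const_smul t)).aestronglyMeasurable).1 h

theorem integral_norm_rotated_residual_sq (U : Submodule ℝ E) (μ a : E) (k l m : ℝ) :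
    Integrable (fun b => ‖missed U μ + k • b - l • U.starProjection a
        - m • U.starProjection b‖ ^ 2) (stdGaussian E) ∧
      ∫ b, ‖missed U μ + k • b - l • U.starProjection a - m • U.starProjection b‖ ^ 2
        ∂(stdGaussian E)
      = ‖missed U μ‖ ^ 2 + l ^ 2 * ‖U.starProjection a‖ ^ 2 + k ^ 2 * Module.finrank ℝ E
        + (m ^ 2 - 2 * k * m) * Module.finrank ℝ U := by
  simp_rw [norm_rotated_residual_sq]
  have i1 : Integrable (fun _ : E => ‖missed U μ‖ ^ 2 + l ^ 2 * ‖U.starProjection a‖ ^ 2)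
    (stdGaussian E) := integrable_const _
  have i2 := (integrable_norm_pow_stdGaussian (E := E) 2).const_mul (k ^ 2)
  have i3' : Integrable (fun b => ‖U.starProjection b‖ ^ 2) (stdGaussian E) := by
    refine (integrable_norm_pow_stdGaussian (E := E) 2).mono' (by fun_prop)
      (ae_of_all _ fun z => ?_)
    rw [norm_pow, norm_norm]
    gcongr
    exact U.norm_starProjection_apply_le z
  have i3 := i3'.const_mul (m ^ 2 - 2 * k * m)
  have i4 := (integrable_inner_stdGaussian (missed U μ)).const_mul (2 * k)
  have i5 := (integrable_inner_stdGaussian (U.starProjection a)).const_mul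
    (2 * l * m - 2 * k * l)
  refine ⟨(((i1.add i2).add i3).add i4).add i5,
    (integral_add' (((i1.add i2).add i3).add i4) i5).trans ?_⟩
  rw [integral_add' ((i1.add i2).add i3) i4, integral_add' (i1.add i2) i3, integral_add' i1 i2]
  simp only [integral_const_mul, integral_const, probReal_univ, one_smul,
    integral_inner_stdGaussian, integral_norm_starProjection_sq_stdGaussian,
    integral_norm_sq_stdGaussian, mul_zero, add_zero]

theorem integrable_modelLoss (U : ι → Submodule ℝ E) {S : E → ι} (hS : Measurable S) (μ : E)
    (σ : ℝ) :
    Integrable (fun x : E × E => modelLoss U S (μ + σ • x.1, μ + σ • x.2))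
      ((stdGaussian E).prod (stdGaussian E)) := by
  have h2 := (integrable_norm_pow_stdGaussian (E := E) 2).const_mul (σ ^ 2)
  refine ((((integrable_const (4 * ‖μ‖ ^ 2)).add (h2.comp_fst (stdGaussian E))).add
    (h2.comp_snd (stdGaussian E))).const_mul 3).mono' ?_ (ae_of_all _ fun x => ?_)
  · exact ((measurable_modelLoss U hS).comp (by fun_prop :
      Measurable fun x : E × E => (μ + σ • x.1, μ + σ • x.2))).aestronglyMeasurable
  · simp only [modelLoss, Pi.add_apply]
    rw [norm_pow, norm_norm]
    have h1 : ‖μ + σ • x.2 - (U (S (μ + σ • x.1))).starProjection (μ + σ • x.1)‖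
        ≤ 2 * ‖μ‖ + |σ| * ‖x.1‖ + |σ| * ‖x.2‖ := by
      have e1 := norm_sub_le (μ + σ • x.2)
        ((U (S (μ + σ • x.1))).starProjection (μ + σ • x.1))
      have e2 := (U (S (μ + σ • x.1))).norm_starProjection_apply_le (μ + σ • x.1)
      have e3 := norm_add_le μ (σ • x.1)
      have e4 := norm_add_le μ (σ • x.2)
      rw [norm_smul, Real.norm_eq_abs] at e3 e4
      linarith
    refine (pow_le_pow_left₀ (norm_nonneg _) h1 2).trans ?_
    rw [← sq_abs σ]
    nlinarith [sq_nonneg (2 * ‖μ‖ - |σ| * ‖x.1‖), sq_nonneg (2 * ‖μ‖ - |σ| * ‖x.2‖),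
      sq_nonneg (|σ| * ‖x.1‖ - |σ| * ‖x.2‖)]

theorem integral_modelLoss (U : ι → Submodule ℝ E) {S : E → ι} (hS : Measurable S) (μ : E)
    (σ : ℝ) :
    ∫ x : E × E, modelLoss U S (μ + σ • x.1, μ + σ • x.2) ∂((stdGaussian E).prod (stdGaussian E))
      = (∫ z, fitRisk U S μ (σ • z) ∂(stdGaussian E)) + σ ^ 2 * Module.finrank ℝ E := by
  rw [integral_prod _ (integrable_modelLoss U hS μ σ)]
  have h : ∀ z : E, ∫ w, modelLoss U S (μ + σ • z, μ + σ • w) ∂(stdGaussian E)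
      = fitRisk U S μ (σ • z) + σ ^ 2 * Module.finrank ℝ E := by
    intro z
    -- The independent copy `y_new` corresponds to equal weights `σ` and no projection of the second
    -- vector.
    have h1 := (integral_norm_rotated_residual_sq (U (S (μ + σ • z))) μ z σ σ 0).2
    have h2 : ∀ w, modelLoss U S (μ + σ • z, μ + σ • w)
        = ‖missed (U (S (μ + σ • z))) μ + σ • w - σ • (U (S (μ + σ • z))).starProjection z
          - (0 : ℝ) • (U (S (μ + σ • z))).starProjection w‖ ^ 2 := by
      intro w
      simp only [modelLoss, missed, zero_smul, sub_zero, map_add, map_smul]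
      congr 2
      abel
    simp_rw [h2, h1, fitRisk, map_smul, norm_smul, mul_pow, Real.norm_eq_abs, sq_abs]
    ring
  simp_rw [h]
  rw [integral_add (integrable_fitRisk U hS μ σ) (integrable_const _)]
  simp

/-- In rotated coordinates `y* = μ + σ√(1+α) a` and `y⁻ = μ + (σ√(1+α)/√α) b`. The selected model is
then a function of `a` alone, while `y` still mixes both vectors. -/
theorem modelErr_rotation (U : ι → Submodule ℝ E) (S : E → ι) (μ a b : E) {σ α : ℝ} (hσ : 0 < σ)
    (hα : 0 < α) :
    modelErr σ U S α (gaussianPair μ σ (√(α * σ ^ 2))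
        ((√(1 + α))⁻¹ • a + (√α / √(1 + α)) • b, (√α / √(1 + α)) • a - (√(1 + α))⁻¹ • b))
      = ‖missed (U (S (μ + √((1 + α) * σ ^ 2) • a))) μ + (σ * √(1 + α) / √α) • b
          - (σ / √(1 + α)) • (U (S (μ + √((1 + α) * σ ^ 2) • a))).starProjection a
          - (σ * √α / √(1 + α)) • (U (S (μ + √((1 + α) * σ ^ 2) • a))).starProjection b‖ ^ 2
        + 2 * (Module.finrank ℝ (U (S (μ + √((1 + α) * σ ^ 2) • a))) : ℝ) * σ ^ 2
        - α⁻¹ * (Module.finrank ℝ E : ℝ) * σ ^ 2 := by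
  have h1 : √((1 + α) * σ ^ 2) = √(1 + α) * σ := by
    rw [Real.sqrt_mul (by linarith), Real.sqrt_sq hσ.le]
  have h2 : √(α * σ ^ 2) = √α * σ := by rw [Real.sqrt_mul hα.le, Real.sqrt_sq hσ.le]
  have hr : √(1 + α) ^ 2 = 1 + α := Real.sq_sqrt (by linarith)
  have hs : √α ^ 2 = α := Real.sq_sqrt hα.le
  have hr0 : 0 < √(1 + α) := Real.sqrt_pos.2 (by linarith)
  have hs0 : 0 < √α := Real.sqrt_pos.2 hα
  rw [h1, h2]
  set r := √(1 + α)
  set s := √α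
  have hsum : μ + σ • (r⁻¹ • a + (s / r) • b) + (s * σ) • ((s / r) • a - r⁻¹ • b)
      = μ + (r * σ) • a := by
    have : r⁻¹ + s * (s / r) = r := by field_simp; rw [hr, hs]
    calc _ = μ + (σ * (r⁻¹ + s * (s / r))) • a := by module
      _ = _ := by rw [this, mul_comm]
  have hy : μ + σ • (r⁻¹ • a + (s / r) • b) - α⁻¹ • ((s * σ) • ((s / r) • a - r⁻¹ • b))
      = μ + (σ * r / s) • b := by
    have e1 : α⁻¹ * ((s * σ) * (s / r)) = σ * r⁻¹ := by rw [← hs]; field_simp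
    have e2 : σ * (s / r) + α⁻¹ * ((s * σ) * r⁻¹) = σ * r / s := by
      field_simp; rw [hr, hs]; field_simp; ring
    have e3 : α⁻¹ • ((s * σ) • ((s / r) • a - r⁻¹ • b))
        = (σ * r⁻¹) • a - (α⁻¹ * ((s * σ) * r⁻¹)) • b := by
      rw [← e1]; module
    rw [e3, ← e2]
    module
  have hdef : ∀ i, i = S (μ + σ • (r⁻¹ • a + (s / r) • b) + (s * σ) • ((s / r) • a - r⁻¹ • b)) →
      modelErr σ U S α (gaussianPair μ σ (s * σ)
        (r⁻¹ • a + (s / r) • b, (s / r) • a - r⁻¹ • b))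
      = ‖μ + σ • (r⁻¹ • a + (s / r) • b) - α⁻¹ • ((s * σ) • ((s / r) • a - r⁻¹ • b))
          - (U i).starProjection (μ + σ • (r⁻¹ • a + (s / r) • b))‖ ^ 2
        + 2 * (Module.finrank ℝ (U i) : ℝ) * σ ^ 2
        - α⁻¹ * (Module.finrank ℝ E : ℝ) * σ ^ 2 := by
    rintro i rfl; rfl
  rw [hdef _ (congrArg S hsum).symm, hy]
  congr 4
  simp only [missed, map_add, map_smul]
  module

/-- With `a` fixed, integrating over `b` removes the linear terms. The cross term of `b` with its
projection has mean `-2σ²` times the rank, which the trace penalty cancels exactly, and `-nσ²/α`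
reduces the mean of the `‖b‖²` term to `σ² n`. -/
theorem integral_modelErr {S : E → ι} (hS : Measurable S) {σ α : ℝ} (hσ : 0 < σ) (hα : 0 < α)
    (hi : Integrable (fun x => modelErr σ U S α (gaussianPair μ σ (√(α * σ ^ 2)) x))
      ((stdGaussian E).prod (stdGaussian E))) :
    ∫ x, modelErr σ U S α (gaussianPair μ σ (√(α * σ ^ 2)) x)
        ∂((stdGaussian E).prod (stdGaussian E))
      = ∫ a, (fitRisk U S μ (√((1 + α) * σ ^ 2) • a) + σ ^ 2 * Module.finrank ℝ E
        + (α * σ ^ 2 / (1 + α) * Module.finrank ℝ (U (S (μ + √((1 + α) * σ ^ 2) • a)))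
          - α * (2 + α) * σ ^ 2 / (1 + α)
            * ‖(U (S (μ + √((1 + α) * σ ^ 2) • a))).starProjection a‖ ^ 2)) ∂(stdGaussian E) := by
  have h : ((√(1 + α))⁻¹) ^ 2 + (√α / √(1 + α)) ^ 2 = 1 := by
    rw [inv_pow, div_pow, Real.sq_sqrt (by linarith), Real.sq_sqrt hα.le]; field_simp
  have hrot := stdGaussian_prod_map_rotation (E := E) h
  have hm : Measurable fun p : E × E => ((√(1 + α))⁻¹ • p.1 + (√α / √(1 + α)) • p.2,
    (√α / √(1 + α)) • p.1 - (√(1 + α))⁻¹ • p.2) := by fun_prop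
  have hi' := (integrable_map_measure (by rw [hrot]; exact hi.1) hm.aemeasurable).1
    (by rw [hrot]; exact hi)
  have hG : Measurable fun x => modelErr σ U S α (gaussianPair μ σ (√(α * σ ^ 2)) x) :=
    (measurable_modelErr σ U hS α).comp (measurable_gaussianPair _ _ _)
  conv_lhs => rw [← hrot]
  rw [integral_map hm.aemeasurable hG.aestronglyMeasurable]
  refine (integral_prod _ hi').trans ?_
  refine integral_congr_ae (ae_of_all _ fun a => ?_)
  refine (integral_congr_ae (ae_of_all _ fun b => modelErr_rotation U S μ a b hσ hα)).trans ?_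
  beta_reduce
  set i := S (μ + √((1 + α) * σ ^ 2) • a) with hidef
  obtain ⟨hint, hval⟩ := integral_norm_rotated_residual_sq (U i) μ a (σ * √(1 + α) / √α)
    (σ / √(1 + α)) (σ * √α / √(1 + α))
  have hsplit : ∀ b, ‖missed (U i) μ + (σ * √(1 + α) / √α) • b
      - (σ / √(1 + α)) • (U i).starProjection a
      - (σ * √α / √(1 + α)) • (U i).starProjection b‖ ^ 2
        + 2 * (Module.finrank ℝ (U i) : ℝ) * σ ^ 2 - α⁻¹ * (Module.finrank ℝ E : ℝ) * σ ^ 2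
      = ‖missed (U i) μ + (σ * √(1 + α) / √α) • b
      - (σ / √(1 + α)) • (U i).starProjection a
      - (σ * √α / √(1 + α)) • (U i).starProjection b‖ ^ 2
        + (2 * (Module.finrank ℝ (U i) : ℝ) * σ ^ 2 - α⁻¹ * (Module.finrank ℝ E : ℝ) * σ ^ 2) :=
    fun b => by ring
  simp_rw [hsplit]
  rw [integral_add hint (integrable_const _), hval]
  simp only [integral_const, probReal_univ, one_smul]
  have hf : fitRisk U S μ (√((1 + α) * σ ^ 2) • a)
      = ‖missed (U i) μ‖ ^ 2 + (1 + α) * σ ^ 2 * ‖(U i).starProjection a‖ ^ 2 := by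
    rw [fitRisk, map_smul, norm_sqrt_smul_sq (by positivity)]
  rw [hf]
  have hr : √(1 + α) ^ 2 = 1 + α := Real.sq_sqrt (by linarith)
  have hs : √α ^ 2 = α := Real.sq_sqrt hα.le
  have hr0 : 0 < √(1 + α) := Real.sqrt_pos.2 (by linarith)
  have hs0 : 0 < √α := Real.sqrt_pos.2 hα
  have e1 : (σ / √(1 + α)) ^ 2 = σ ^ 2 / (1 + α) := by rw [div_pow, hr]
  have e2 : (σ * √(1 + α) / √α) ^ 2 = σ ^ 2 * (1 + α) / α := by rw [div_pow, mul_pow, hr, hs]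
  have e3 : (σ * √α / √(1 + α)) ^ 2 = σ ^ 2 * α / (1 + α) := by rw [div_pow, mul_pow, hr, hs]
  have e4 : 2 * (σ * √(1 + α) / √α) * (σ * √α / √(1 + α)) = 2 * σ ^ 2 := by field_simp
  rw [e1, e2, e3, e4]
  have : 1 + α ≠ 0 := by positivity
  field_simp
  ring

/-- The bias of the error estimator is of the order of `α`. -/
theorem abs_integral_modelErr_sub_le {S : E → ι} (hS : Measurable S)
    (hQ : Integrable Q (stdGaussian E)) (hP : ∀ i z, ‖(U i).starProjection z‖ ^ 4 ≤ Q z)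
    {σ α A q : ℝ} (hσ : 0 < σ) (hα : 0 < α) (hq : ∫ z, Q z ∂(stdGaussian E) ≤ q)
    (hA : ∀ τ ∈ Set.Icc (σ ^ 2) ((1 + α) * σ ^ 2),
      ∫ z, ‖missed (U (S (μ + √τ • z))) μ‖ ^ 4 ∂(stdGaussian E) ≤ A)
    (hi : Integrable (fun x => modelErr σ U S α (gaussianPair μ σ (√(α * σ ^ 2)) x))
      ((stdGaussian E).prod (stdGaussian E))) :
    |(∫ x, modelErr σ U S α (gaussianPair μ σ (√(α * σ ^ 2)) x)
        ∂((stdGaussian E).prod (stdGaussian E)))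
      - ∫ x : E × E, modelLoss U S (μ + σ • x.1, μ + σ • x.2)
        ∂((stdGaussian E).prod (stdGaussian E))|
      ≤ α * σ ^ 2 * (A + ((1 + α) * σ ^ 2) ^ 2 * q + 12 * Module.finrank ℝ E / σ ^ 4
        + 3 / 2 * (1 + q)) := by
  rw [integral_modelErr hS hσ hα hi, integral_modelLoss U hS]
  set t := √((1 + α) * σ ^ 2) with ht
  set d : ℝ := (Module.finrank ℝ E : ℝ)
  have hα1 : (0 : ℝ) < 1 + α := by linarith
  let g : E → ℝ := fun a => α * σ ^ 2 / (1 + α) * Module.finrank ℝ (U (S (μ + t • a)))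
    - α * (2 + α) * σ ^ 2 / (1 + α) * ‖(U (S (μ + t • a))).starProjection a‖ ^ 2
  have hgm : Measurable g := measurable_select (F := fun i a => α * σ ^ 2 / (1 + α)
    * Module.finrank ℝ (U i) - α * (2 + α) * σ ^ 2 / (1 + α) * ‖(U i).starProjection a‖ ^ 2)
    (fun i => by fun_prop) (T := fun a : E => S (μ + t • a)) (by fun_prop)
  have hb : Integrable (fun a : E => α * σ ^ 2 * ((1 + q) / 2) + α * σ ^ 2 * (1 + Q a))
      (stdGaussian E) :=
    (integrable_const _).add (((integrable_const 1).add hQ).const_mul _)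
  have hgb : ∀ a, ‖g a‖ ≤ α * σ ^ 2 * ((1 + q) / 2) + α * σ ^ 2 * (1 + Q a) := by
    intro a
    have h1 := (finrank_sq_le_integral hQ hP (S (μ + t • a))).trans hq
    have h2 := hP (S (μ + t • a)) a
    simp only [g, Real.norm_eq_abs]
    set r : ℝ := (Module.finrank ℝ (U (S (μ + t • a))) : ℝ)
    set y := ‖(U (S (μ + t • a))).starProjection a‖
    have h3 : r ≤ (1 + q) / 2 := by nlinarith [sq_nonneg (r - 1)]
    have h4 : 2 * y ^ 2 ≤ 1 + Q a := by nlinarith [sq_nonneg (y ^ 2 - 1)]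
    have hr0 : 0 ≤ r := by positivity
    have c1 : α * σ ^ 2 / (1 + α) ≤ α * σ ^ 2 :=
      div_le_self (by positivity) (by linarith)
    -- This is `(2 + α)/(1 + α) ≤ 2`, so the remainder is linear in `α` without an upper bound on
    -- `α`.
    have c2 : α * (2 + α) * σ ^ 2 / (1 + α) ≤ α * σ ^ 2 * 2 := by
      rw [div_le_iff₀ hα1]
      nlinarith [mul_pos hα (pow_pos hσ 2), mul_pos (mul_pos hα (pow_pos hσ 2)) hα]
    refine (abs_sub _ _).trans ?_
    rw [abs_of_nonneg (by positivity), abs_of_nonneg (by positivity)]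
    refine add_le_add ?_ ?_
    · exact mul_le_mul c1 h3 hr0 (by positivity)
    · calc _ ≤ α * σ ^ 2 * 2 * y ^ 2 := by gcongr
        _ = α * σ ^ 2 * (2 * y ^ 2) := by ring
        _ ≤ _ := by gcongr
  have hg : Integrable g (stdGaussian E) := hb.mono' hgm.aestronglyMeasurable (ae_of_all _ hgb)
  have i1 : Integrable (fun a => 1 + Q a) (stdGaussian E) := (integrable_const 1).add hQ
  have hgI : |∫ a, g a ∂(stdGaussian E)| ≤ α * σ ^ 2 * (3 / 2 * (1 + q)) := by
    refine (norm_integral_le_of_norm_le hb (ae_of_all _ hgb)).trans ?_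
    rw [integral_add (integrable_const _) (i1.const_mul _),
      integral_const_mul (α * σ ^ 2) (fun a => 1 + Q a), integral_add (integrable_const _) hQ]
    simp only [integral_const, probReal_univ, one_smul]
    have := mul_le_mul_of_nonneg_left hq (by positivity : 0 ≤ α * σ ^ 2)
    linarith
  have hsplit : ∫ a, (fitRisk U S μ (t • a) + σ ^ 2 * d + g a) ∂(stdGaussian E)
      = (∫ a, fitRisk U S μ (t • a) ∂(stdGaussian E)) + σ ^ 2 * d
        + ∫ a, g a ∂(stdGaussian E) := by
    have i2 : Integrable (fun a => fitRisk U S μ (t • a) + σ ^ 2 * d) (stdGaussian E) :=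
      (integrable_fitRisk U hS μ t).add (integrable_const _)
    rw [integral_add i2 hg, integral_add (integrable_fitRisk U hS μ t) (integrable_const _)]
    simp
  change |(∫ a, (fitRisk U S μ (t • a) + σ ^ 2 * d + g a) ∂(stdGaussian E)) - _| ≤ _
  rw [hsplit]
  have hQ0 : 0 ≤ ∫ z, Q z ∂(stdGaussian E) ∨ IsEmpty ι := by
    rcases isEmpty_or_nonempty ι with h | ⟨⟨i⟩⟩
    · exact Or.inr h
    · exact Or.inl (integral_nonneg fun z => (by positivity : (0 : ℝ) ≤ _).trans (hP i z))
  -- The two risks are one function at the variances `σ²` and `(1+α)σ²`. The value of `D` comes from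
  -- `(x+y)² ≤ 2x² + 2y²` applied to the two parts of the risk.
  have hlip := abs_integral_comp_sqrt_smul_sub_le (measurable_fitRisk U hS μ)
    (abs_fitRisk_le U S μ) (a := σ ^ 2) (b := (1 + α) * σ ^ 2)
    (D := 2 * A + 2 * ((1 + α) * σ ^ 2) ^ 2 * q) (by positivity)
    (by nlinarith [pow_pos hσ 2]) (by
      intro τ hτ
      have hτ0 : 0 ≤ τ := (by positivity : (0 : ℝ) ≤ σ ^ 2).trans hτ.1
      have i1 : Integrable (fun z => ‖missed (U (S (μ + √τ • z))) μ‖ ^ 4) (stdGaussian E) :=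
        integrable_missed_comp _ U μ 4 (by fun_prop)
      have hle : ∫ z, fitRisk U S μ (√τ • z) ^ 2 ∂(stdGaussian E)
          ≤ ∫ z, (2 * ‖missed (U (S (μ + √τ • z))) μ‖ ^ 4 + 2 * τ ^ 2 * Q z)
            ∂(stdGaussian E) := by
        refine integral_mono_of_nonneg (ae_of_all _ fun z => sq_nonneg _)
          ((i1.const_mul 2).add (hQ.const_mul (2 * τ ^ 2))) (ae_of_all _ fun z => ?_)
        simp only
        rw [fitRisk, map_smul, norm_sqrt_smul_sq hτ0]
        have h := mul_le_mul_of_nonneg_left (hP (S (μ + √τ • z)) z)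
          (by positivity : 0 ≤ 2 * τ ^ 2)
        nlinarith [sq_nonneg (‖missed (U (S (μ + √τ • z))) μ‖ ^ 2
          - τ * ‖(U (S (μ + √τ • z))).starProjection z‖ ^ 2)]
      rw [integral_add (i1.const_mul 2) (hQ.const_mul _), integral_const_mul,
        integral_const_mul] at hle
      have hq0 : 0 ≤ q := by
        rcases hQ0 with h | h
        · exact h.trans hq
        · exact (h.elim (S 0))
      have h1 : 2 * τ ^ 2 * ∫ z, Q z ∂(stdGaussian E) ≤ 2 * ((1 + α) * σ ^ 2) ^ 2 * q := by
        have := hτ.2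
        calc _ ≤ 2 * τ ^ 2 * q := by gcongr
          _ ≤ _ := by gcongr
      linarith [hA τ hτ])
  rw [Real.sqrt_sq hσ.le] at hlip
  have hfin : (2 * A + 2 * ((1 + α) * σ ^ 2) ^ 2 * q + 24 * d / (σ ^ 2) ^ 2) / 2
      * ((1 + α) * σ ^ 2 - σ ^ 2)
      = α * σ ^ 2 * (A + ((1 + α) * σ ^ 2) ^ 2 * q + 12 * d / σ ^ 4) := by
    field_simp; ring
  rw [hfin] at hlip
  rw [abs_le] at hlip hgI ⊢
  constructor <;> linarith [hlip.1, hlip.2, hgI.1, hgI.2]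

end ModelBias

/-! ### From hat matrices and selection rules to projections and measurable maps. -/

section LinearModel

variable {n p : ℕ}

open scoped MatrixOrder in
theorem isoGaussian_eq_map (μ : EuclideanSpace ℝ (Fin n)) {τ : ℝ} (hτ : 0 ≤ τ) :
    isoGaussian μ τ = (stdGaussian (EuclideanSpace ℝ (Fin n))).map fun z => μ + √τ • z := by
  have h : CFC.sqrt (τ • (1 : Matrix (Fin n) (Fin n) ℝ)) = √τ • (1 : Matrix (Fin n) (Fin n) ℝ) := by
    refine CFC.sqrt_unique ?_ ?_
    · rw [smul_mul_smul_comm, mul_one, Real.mul_self_sqrt hτ]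
    · exact (Matrix.PosSemidef.one.smul (Real.sqrt_nonneg τ)).nonneg
  rw [isoGaussian, multivariateGaussian, h]
  simp

theorem isoGaussian_absolutelyContinuous (μ : EuclideanSpace ℝ (Fin n)) {τ : ℝ} (hτ : 0 < τ) :
    isoGaussian μ τ ≪ volume := by
  have h1 := (map_smul_stdGaussian_absolutelyContinuous (E := EuclideanSpace ℝ (Fin n)) hτ).map
    (measurable_const_add μ)
  rw [Measure.map_map (by fun_prop) (by fun_prop), map_add_left_eq_self] at h1
  rw [isoGaussian_eq_map μ hτ.le]
  exact h1

theorem isProbabilityMeasure_isoGaussian (μ : EuclideanSpace ℝ (Fin n)) (τ : ℝ) :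
    IsProbabilityMeasure (isoGaussian μ τ) := by
  unfold isoGaussian; infer_instance

theorem isProbabilityMeasure_randomizedLaw (σ : ℝ) (μ : EuclideanSpace ℝ (Fin n)) (α : ℝ) :
    IsProbabilityMeasure (randomizedLaw σ μ α) := by
  have := isProbabilityMeasure_isoGaussian μ (σ ^ 2)
  have := isProbabilityMeasure_isoGaussian (0 : EuclideanSpace ℝ (Fin n)) (α * σ ^ 2)
  unfold randomizedLaw; infer_instance

theorem randomizedLaw_eq_map {σ : ℝ} (hσ : 0 < σ) (μ : EuclideanSpace ℝ (Fin n)) {α : ℝ}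
    (hα : 0 < α) : randomizedLaw σ μ α
      = ((stdGaussian (EuclideanSpace ℝ (Fin n))).prod (stdGaussian _)).map
        (gaussianPair μ σ (√(α * σ ^ 2))) := by
  rw [randomizedLaw, isoGaussian_eq_map _ (by positivity), isoGaussian_eq_map _ (by positivity),
    Measure.map_prod_map _ _ (by fun_prop) (by fun_prop), Real.sqrt_sq hσ.le]
  congr 1
  ext x <;> simp [gaussianPair]

theorem predLaw_eq_map {σ : ℝ} (hσ : 0 < σ) (μ : EuclideanSpace ℝ (Fin n)) :
    (isoGaussian μ (σ ^ 2)).prod (isoGaussian μ (σ ^ 2))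
      = ((stdGaussian (EuclideanSpace ℝ (Fin n))).prod (stdGaussian _)).map
        fun x => (μ + σ • x.1, μ + σ • x.2) := by
  rw [isoGaussian_eq_map _ (by positivity),
    Measure.map_prod_map _ _ (by fun_prop) (by fun_prop), Real.sqrt_sq hσ.le]
  rfl

/-- The column space of the submatrix `X_M`. -/
noncomputable def modelSpace (X : Matrix (Fin n) (Fin p) ℝ) (M : Finset (Fin p)) :
    Submodule ℝ (EuclideanSpace ℝ (Fin n)) :=
  (Matrix.toEuclideanCLM (𝕜 := ℝ) (hatMatrix X M)).range

section HatMatrix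

variable {X : Matrix (Fin n) (Fin p) ℝ} {M : Finset (Fin p)}

theorem isStarProjection_hatMatrix (h : IsUnit ((subDesign X M)ᵀ * subDesign X M)) :
    IsStarProjection (hatMatrix X M) := by
  set A := subDesign X M with hA
  have hd : IsUnit (Aᵀ * A).det := (Matrix.isUnit_iff_isUnit_det _).1 h
  constructor
  · change hatMatrix X M * hatMatrix X M = hatMatrix X M
    simp only [hatMatrix, ← hA]
    calc A * (Aᵀ * A)⁻¹ * Aᵀ * (A * (Aᵀ * A)⁻¹ * Aᵀ)
        = A * (((Aᵀ * A)⁻¹ * (Aᵀ * A)) * (Aᵀ * A)⁻¹) * Aᵀ := by simp only [Matrix.mul_assoc]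
      _ = _ := by rw [Matrix.nonsing_inv_mul _ hd, Matrix.one_mul]
  · change (hatMatrix X M)ᴴ = hatMatrix X M
    simp only [hatMatrix, ← hA, Matrix.conjTranspose_eq_transpose_of_trivial, Matrix.transpose_mul,
      Matrix.transpose_transpose, Matrix.transpose_nonsing_inv, Matrix.mul_assoc]

theorem toEuclideanCLM_hatMatrix (h : IsUnit ((subDesign X M)ᵀ * subDesign X M)) :
    Matrix.toEuclideanCLM (𝕜 := ℝ) (hatMatrix X M) = (modelSpace X M).starProjection := by
  have h1 : IsStarProjection (Matrix.toEuclideanCLM (𝕜 := ℝ) (hatMatrix X M)) :=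
    (isStarProjection_hatMatrix h).map _
  obtain ⟨h2, h3⟩ := isStarProjection_iff_eq_starProjection_range.1 h1
  exact h3

theorem fit_eq_starProjection (h : IsUnit ((subDesign X M)ᵀ * subDesign X M))
    (v : EuclideanSpace ℝ (Fin n)) : fit X M v = (modelSpace X M).starProjection v := by
  rw [← toEuclideanCLM_hatMatrix h]; rfl

theorem trace_hatMatrix_eq_card (h : IsUnit ((subDesign X M)ᵀ * subDesign X M)) :
    (hatMatrix X M).trace = M.card := by
  rw [hatMatrix, Matrix.mul_assoc, Matrix.trace_mul_comm, Matrix.mul_assoc,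
    Matrix.nonsing_inv_mul _ ((Matrix.isUnit_iff_isUnit_det _).1 h), Matrix.trace_one]
  simp

theorem trace_hatMatrix_eq_finrank (h : IsUnit ((subDesign X M)ᵀ * subDesign X M)) :
    (hatMatrix X M).trace = Module.finrank ℝ (modelSpace X M) := by
  have hp : LinearMap.IsProj (modelSpace X M) (Matrix.toEuclideanLin (hatMatrix X M)) := by
    rw [← Matrix.coe_toEuclideanCLM_eq_toEuclideanLin, toEuclideanCLM_hatMatrix h]
    exact ⟨fun x => Submodule.starProjection_apply_mem _ x,
      fun x hx => Submodule.starProjection_eq_self_iff.2 hx⟩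
  rw [← hp.trace, Matrix.toEuclideanLin_eq_toLin_orthonormal, Matrix.trace_toLin_eq]

theorem finrank_modelSpace (h : IsUnit ((subDesign X M)ᵀ * subDesign X M)) :
    Module.finrank ℝ (modelSpace X M) = M.card := by
  have := (trace_hatMatrix_eq_finrank h).symm.trans (trace_hatMatrix_eq_card h)
  exact_mod_cast this

end HatMatrix

/-- A set of at most `m` columns is coded by `m` symbols: the entries of its list, padded with
`none`. The alphabet `Option (Fin p)` has `p + 1` symbols. -/
theorem card_le_of_forall_card_le (s : Set (Finset (Fin p))) {m : ℕ} (hs : ∀ M ∈ s, M.card ≤ m) :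
    Nat.card s ≤ (p + 1) ^ m := by
  have hinj : Function.Injective
      (fun (M : s) (j : Fin m) => (M : Finset (Fin p)).toList[(j : ℕ)]?) := by
    intro M M' hM
    have hl : (M : Finset (Fin p)).toList = (M' : Finset (Fin p)).toList := by
      refine List.ext_getElem? fun i => ?_
      by_cases hi : i < m
      · exact congrFun hM ⟨i, hi⟩
      · rw [List.getElem?_eq_none, List.getElem?_eq_none]
        · rw [Finset.length_toList]; exact (hs _ M'.2).trans (not_lt.1 hi)
        · rw [Finset.length_toList]; exact (hs _ M.2).trans (not_lt.1 hi)
    exact Subtype.ext (by rw [← Finset.toList_toFinset M.1, hl, Finset.toList_toFinset])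
  refine (Nat.card_le_card_of_injective _ hinj).trans (le_of_eq ?_)
  simp [Nat.card_eq_fintype_card]

/-- A set with null frontier is null measurable, and there are finitely many models. The modified
rule must keep its values in the range of the original one, the only place where invertibility is
assumed. -/
theorem exists_measurable_selection {Mhat : EuclideanSpace ℝ (Fin n) → Finset (Fin p)}
    (h : ∀ M ∈ Set.range Mhat, volume (frontier (Mhat ⁻¹' {M})) = 0) :
    ∃ S : EuclideanSpace ℝ (Fin n) → Set.range Mhat, Measurable[_, ⊤] S ∧
      ∀ᵐ u, Mhat u = S u := by
  let : MeasurableSpace (Finset (Fin p)) := ⊤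
  have hm : NullMeasurable Mhat volume := by
    intro t _
    have ht : Mhat ⁻¹' t = ⋃ M ∈ t, Mhat ⁻¹' {M} := by ext; simp
    rw [ht]
    refine NullMeasurableSet.biUnion t.to_countable fun M _ => ?_
    by_cases hM : M ∈ Set.range Mhat
    · exact nullMeasurableSet_of_null_frontier (h M hM)
    · rw [Set.preimage_singleton_eq_empty.2 hM]; exact nullMeasurableSet_empty
  obtain ⟨g, hg, hr, hgM⟩ := hm.aemeasurable.exists_ae_eq_range_subset
    (t := Set.range Mhat) (ae_of_all _ fun u => ⟨u, rfl⟩) ⟨_, 0, rfl⟩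
  refine ⟨fun u => ⟨g u, hr ⟨u, rfl⟩⟩, ?_, hgM⟩
  let : MeasurableSpace (Set.range Mhat) := ⊤
  refine measurable_to_countable' fun M => ?_
  have : (fun u => (⟨g u, hr ⟨u, rfl⟩⟩ : Set.range Mhat)) ⁻¹' {M} = g ⁻¹' {M.1} := by
    ext u; simp [Subtype.ext_iff]
  rw [this]
  exact hg trivial

/-- Changing the rule on a null set is harmless because the joint law has a density and the preimage
of a null set under addition is null. -/
theorem errHat_ae_eq {Mhat Mhat' : EuclideanSpace ℝ (Fin n) → Finset (Fin p)}
    (h : ∀ᵐ u, Mhat u = Mhat' u) (X : Matrix (Fin n) (Fin p) ℝ) (μ : EuclideanSpace ℝ (Fin n))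
    {σ α : ℝ} (hσ : 0 < σ) (hα : 0 < α) :
    errHat σ X Mhat α =ᵐ[randomizedLaw σ μ α] errHat σ X Mhat' α := by
  have hac : randomizedLaw σ μ α
      ≪ (volume : Measure (EuclideanSpace ℝ (Fin n))).prod volume :=
    (isoGaussian_absolutelyContinuous μ (by positivity)).prod
      (isoGaussian_absolutelyContinuous 0 (by positivity))
  have h1 := (quasiMeasurePreserving_add (volume : Measure (EuclideanSpace ℝ (Fin n)))
    volume).tendsto_ae.eventually h
  filter_upwards [hac.ae_le h1] with z hz
  simp only [errHat, hz]

theorem predLoss_ae_eq {Mhat Mhat' : EuclideanSpace ℝ (Fin n) → Finset (Fin p)}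
    (h : ∀ᵐ u, Mhat u = Mhat' u) (X : Matrix (Fin n) (Fin p) ℝ) (μ : EuclideanSpace ℝ (Fin n))
    {σ : ℝ} (hσ : 0 < σ) :
    predLoss X Mhat =ᵐ[(isoGaussian μ (σ ^ 2)).prod (isoGaussian μ (σ ^ 2))]
      predLoss X Mhat' := by
  have := isProbabilityMeasure_isoGaussian μ (σ ^ 2)
  have h1 := (isoGaussian_absolutelyContinuous μ (by positivity : 0 < σ ^ 2)).ae_le h
  have h2 := (Measure.quasiMeasurePreserving_fst (μ := isoGaussian μ (σ ^ 2))
    (ν := isoGaussian μ (σ ^ 2))).tendsto_ae.eventually h1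
  filter_upwards [h2] with z hz
  simp only [predLoss, hz]

/-- Finite-sample form of the bounds: the moments exist, and the bias and the second moment of the
estimator are controlled by the size of the models and the accuracy of the selection rule. -/
theorem finite_sample_bounds (X : Matrix (Fin n) (Fin p) ℝ) (μ : EuclideanSpace ℝ (Fin n))
    (Mhat : EuclideanSpace ℝ (Fin n) → Finset (Fin p))
    (hregion : ∀ M ∈ Set.range Mhat, volume (frontier (Mhat ⁻¹' {M})) = 0)
    (hinv : ∀ M ∈ Set.range Mhat, IsUnit ((subDesign X M)ᵀ * subDesign X M))
    {m : ℕ} (hm : ∀ M ∈ Set.range Mhat, M.card ≤ m) {l q : ℝ}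
    (hl : 4 * (m * Real.log (p + 1) + (m + 1) / 2 * Real.log 2) ≤ l)
    (hq : 2 * l ^ 2 + 64 ≤ q) {σ : ℝ} (hσ : 0 < σ) :
    Integrable (predLoss X Mhat) ((isoGaussian μ (σ ^ 2)).prod (isoGaussian μ (σ ^ 2))) ∧
    ∀ α, 0 < α → MemLp (errHat σ X Mhat α) 2 (randomizedLaw σ μ α) ∧
      ∀ A, (∀ τ ∈ Set.Icc (σ ^ 2) ((1 + α) * σ ^ 2),
        ∫ u, (‖μ - fit X (Mhat u) μ‖ ^ 2) ^ 2 ∂(isoGaussian μ τ) ≤ A) →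
      |(∫ z, errHat σ X Mhat α z ∂(randomizedLaw σ μ α)) - predError σ X μ Mhat|
          ≤ α * σ ^ 2 * (A + ((1 + α) * σ ^ 2) ^ 2 * q + 12 * n / σ ^ 4 + 3 / 2 * (1 + q)) ∧
      ∫ z, (errHat σ X Mhat α z - σ ^ 2 * n) ^ 2 ∂(randomizedLaw σ μ α)
        ≤ 9 * ((1 + 2 * σ ^ 2 + 2 * (σ ^ 2 / α)) * A
          + (96 * (σ ^ 4 + (σ ^ 2 / α) ^ 2) + 4 * σ ^ 2 * (σ ^ 2 / α)) * n
          + (5 * σ ^ 4 + 2 * σ ^ 2 + 2 * (σ ^ 2 / α) + 4 * σ ^ 2 * (σ ^ 2 / α)) * q) := by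
  obtain ⟨S, hS, hSM⟩ := exists_measurable_selection hregion
  let : MeasurableSpace (Set.range Mhat) := ⊤
  let : Fintype (Set.range Mhat) := Fintype.ofFinite _
  have hfr : Module.finrank ℝ (EuclideanSpace ℝ (Fin n)) = n := finrank_euclideanSpace_fin
  let U : Set.range Mhat → Submodule ℝ (EuclideanSpace ℝ (Fin n)) := fun M => modelSpace X M
  -- Each model is enlarged by the direction of its missed mean, so that one envelope bounds both
  -- the projected noise and the inner products with that mean. This costs one dimension, hence `m +
  -- 1` in the bound on `l`.
  let V : Set.range Mhat → Submodule ℝ (EuclideanSpace ℝ (Fin n)) :=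
    fun M => U M ⊔ Submodule.span ℝ {missed (U M) μ}
  have hlog : 0 ≤ Real.log (p + 1) := Real.log_nonneg (by simp)
  have hlog2 : 0 ≤ Real.log 2 := Real.log_nonneg (by norm_num)
  have hl0 : 0 ≤ l := le_trans (by positivity) hl
  have hV4 := norm_starProjection_pow_four_le_projEnvelope V hl0
  have hP : ∀ i z, ‖(U i).starProjection z‖ ^ 4 ≤ projEnvelope V l z := fun i z =>
    (norm_starProjection_pow_four_le le_sup_left z).trans (hV4 i z)
  have hv : ∀ i z, 2 * inner ℝ (missed (U i) μ) z ^ 2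
      ≤ ‖missed (U i) μ‖ ^ 4 + projEnvelope V l z := fun i z =>
    (two_mul_inner_sq_le_of_mem (V := V i)
      (Submodule.mem_sup_right (Submodule.mem_span_singleton_self _)) z).trans
      (by linarith [hV4 i z])
  have hQ := integrable_projEnvelope V l
  have hqI : ∫ z, projEnvelope V l z ∂(stdGaussian _) ≤ q := by
    refine (integral_projEnvelope_le V (m := m + 1) (fun i => ?_) ?_).trans hq
    · refine (Submodule.finrank_add_le_finrank_add_finrank _ _).trans ?_
      refine add_le_add ?_ ((finrank_span_le_card _).trans (by simp))
      rw [finrank_modelSpace (hinv i i.2)]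
      exact hm i i.2
    · refine le_trans ?_ hl
      have hc : (Fintype.card (Set.range Mhat) : ℝ) ≤ ((p : ℝ) + 1) ^ m := by
        have := card_le_of_forall_card_le (Set.range Mhat) hm
        rw [Nat.card_eq_fintype_card] at this
        exact_mod_cast this
      have hne : (0 : ℝ) < Fintype.card (Set.range Mhat) := by
        have : Nonempty (Set.range Mhat) := ⟨⟨_, 0, rfl⟩⟩
        exact_mod_cast Fintype.card_pos
      have h1 := Real.log_le_log hne hc
      rw [Real.log_pow] at h1
      push_cast
      linarith
  let Mhat' : EuclideanSpace ℝ (Fin n) → Finset (Fin p) := fun u => S u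
  have hae : ∀ᵐ u, Mhat u = Mhat' u := hSM
  have hErr : ∀ α z, errHat σ X Mhat' α z = modelErr σ U S α z := by
    intro α z
    have hi := hinv _ (S (z.1 + z.2)).2
    simp only [errHat, modelErr, Mhat', U, fit_eq_starProjection hi, trace_hatMatrix_eq_finrank hi,
      hfr]
  have hLoss : ∀ z, predLoss X Mhat' z = modelLoss U S z := by
    intro z
    have hi := hinv _ (S z.1).2
    simp only [predLoss, modelLoss, Mhat', U, fit_eq_starProjection hi]
  have hLm := measurable_modelLoss U hS
  have hpm : Measurable fun x : EuclideanSpace ℝ (Fin n) × EuclideanSpace ℝ (Fin n) =>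
    (μ + σ • x.1, μ + σ • x.2) := by fun_prop
  have hPI : predError σ X μ Mhat
      = ∫ x : EuclideanSpace ℝ (Fin n) × EuclideanSpace ℝ (Fin n),
        modelLoss U S (μ + σ • x.1, μ + σ • x.2) ∂((stdGaussian _).prod (stdGaussian _)) := by
    rw [predError, integral_congr_ae (predLoss_ae_eq hae X μ hσ)]
    simp_rw [hLoss]
    rw [predLaw_eq_map hσ, integral_map hpm.aemeasurable hLm.aestronglyMeasurable]
  constructor
  · rw [integrable_congr (predLoss_ae_eq hae X μ hσ), predLaw_eq_map hσ]
    simp_rw [funext hLoss]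
    rw [integrable_map_measure hLm.aestronglyMeasurable hpm.aemeasurable]
    exact integrable_modelLoss U hS μ σ
  intro α hα
  have hEm := measurable_modelErr σ U hS α
  have hgm := measurable_gaussianPair μ σ (√(α * σ ^ 2))
  have hEae : errHat σ X Mhat α =ᵐ[randomizedLaw σ μ α] modelErr σ U S α :=
    (errHat_ae_eq hae X μ hσ hα).trans (ae_of_all _ (hErr α))
  have hmom := fun A => modelErr_second_moment (A := A) hS hQ hP hv hσ hα hqI
  have hprob := isProbabilityMeasure_randomizedLaw σ μ α
  have hL2 : MemLp (modelErr σ U S α) 2 (randomizedLaw σ μ α) := by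
    have h1 : MemLp (fun z => modelErr σ U S α z - σ ^ 2 * n) 2 (randomizedLaw σ μ α) := by
      rw [memLp_two_iff_integrable_sq (hEm.sub_const _).aestronglyMeasurable,
        randomizedLaw_eq_map hσ μ hα, integrable_map_measure
          ((hEm.sub_const _).pow_const 2).aestronglyMeasurable hgm.aemeasurable]
      -- Taking for `A` the integral itself gives integrability without any accuracy assumption.
      have := (hmom _ le_rfl).1
      rw [hfr] at this
      exact this
    have h2 := h1.add (memLp_const (σ ^ 2 * n : ℝ))
    refine h2.ae_eq (ae_of_all _ fun z => ?_)
    simp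
  have hEI : ∫ z, errHat σ X Mhat α z ∂(randomizedLaw σ μ α)
      = ∫ x, modelErr σ U S α (gaussianPair μ σ (√(α * σ ^ 2)) x)
        ∂((stdGaussian _).prod (stdGaussian _)) := by
    rw [integral_congr_ae hEae, randomizedLaw_eq_map hσ μ hα,
      integral_map hgm.aemeasurable hEm.aestronglyMeasurable]
  refine ⟨hL2.ae_eq hEae.symm, fun A hA => ?_⟩
  have hA' : ∀ τ ∈ Set.Icc (σ ^ 2) ((1 + α) * σ ^ 2),
      ∫ z, ‖missed (U (S (μ + √τ • z))) μ‖ ^ 4 ∂(stdGaussian _) ≤ A := by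
    intro τ hτ
    have hτ0 : 0 < τ := (pow_pos hσ 2).trans_le hτ.1
    refine le_trans (le_of_eq ?_) (hA τ hτ)
    have h1 : (fun u => (‖μ - fit X (Mhat u) μ‖ ^ 2) ^ 2) =ᵐ[isoGaussian μ τ]
        fun u => ‖missed (U (S u)) μ‖ ^ 4 := by
      filter_upwards [(isoGaussian_absolutelyContinuous μ hτ0).ae_le hae] with u hu
      rw [hu, fit_eq_starProjection (hinv _ (S u).2), missed]
      ring
    have h2 : Measurable fun u => ‖missed (U (S u)) μ‖ ^ 4 :=
      measurable_select (F := fun i _ => ‖missed (U i) μ‖ ^ 4) (fun _ => measurable_const) hS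
    rw [integral_congr_ae h1, isoGaussian_eq_map μ hτ0.le,
      integral_map (by fun_prop) h2.aestronglyMeasurable]
  constructor
  · have hi : Integrable (fun x => modelErr σ U S α (gaussianPair μ σ (√(α * σ ^ 2)) x))
        ((stdGaussian _).prod (stdGaussian _)) := by
      have := hL2.integrable one_le_two
      rw [randomizedLaw_eq_map hσ μ hα, integrable_map_measure hEm.aestronglyMeasurable
        hgm.aemeasurable] at this
      exact this
    have h := abs_integral_modelErr_sub_le hS hQ hP hσ hα hqI hA' hi
    rw [hEI, hPI]
    rw [hfr] at h
    exact h
  · have h := (hmom A (hA' _ ⟨by nlinarith [pow_pos hσ 2], le_rfl⟩)).2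
    rw [hfr] at h
    have h1 : (fun z => (errHat σ X Mhat α z - σ ^ 2 * n) ^ 2) =ᵐ[randomizedLaw σ μ α]
        fun z => (modelErr σ U S α z - σ ^ 2 * n) ^ 2 := by
      filter_upwards [hEae] with z hz
      rw [hz]
    rw [integral_congr_ae h1, randomizedLaw_eq_map hσ μ hα, integral_map hgm.aemeasurable
      ((hEm.sub_const _).pow_const 2).aestronglyMeasurable]
    exact h

end LinearModel

/-! ### Rates in the sample size. -/

section Asymptotics

/-- The size bound is `min K p` because `log p` vanishes for `p ≤ 1` and then says nothing about
`K`; those cases are absorbed by the constant `8`. Otherwise `log (p+1) ≤ 2 log p` and `log 2 ≤ log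
p`. -/
theorem log_model_count_le (K p : ℕ) :
    4 * ((min K p : ℕ) * Real.log (p + 1) + ((min K p : ℕ) + 1) / 2 * Real.log 2)
      ≤ 8 + 12 * ((K : ℝ) ^ 2 * Real.log p) := by
  have hlog2 : Real.log 2 ≤ 1 := by linarith [Real.log_two_lt_d9]
  have hlog20 : 0 ≤ Real.log 2 := Real.log_nonneg (by norm_num)
  rcases Nat.eq_zero_or_pos K with rfl | hK
  · simp; linarith
  rcases Nat.lt_or_ge p 2 with hp | hp
  · interval_cases p
    · simp; linarith
    · rw [min_eq_right (by omega)]; norm_num; linarith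
  have hK1 : (1 : ℝ) ≤ K := by exact_mod_cast hK
  have hp2 : (2 : ℝ) ≤ p := by exact_mod_cast hp
  have h1 : Real.log 2 ≤ Real.log p := Real.log_le_log (by norm_num) hp2
  have h2 : Real.log (p + 1) ≤ 2 * Real.log p := by
    have h3 : Real.log ((p : ℝ) ^ 2) = 2 * Real.log p := by rw [Real.log_pow]; norm_num
    rw [← h3]
    exact Real.log_le_log (by linarith) (by nlinarith)
  have hm : ((min K p : ℕ) : ℝ) ≤ K := by exact_mod_cast min_le_left K p
  have hlp : 0 ≤ Real.log p := hlog20.trans h1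
  calc _ ≤ 4 * ((K : ℝ) * (2 * Real.log p) + ((K : ℝ) + K) / 2 * Real.log p) := by
        have : 0 ≤ Real.log ((p : ℝ) + 1) := Real.log_nonneg (by linarith)
        gcongr
    _ = 12 * ((K : ℝ) * Real.log p) := by ring
    _ ≤ 12 * ((K : ℝ) ^ 2 * Real.log p) := by
        gcongr; nlinarith
    _ ≤ _ := by linarith

theorem exists_envelope_bound {p K : ℕ → ℕ}
    (hrate : (fun n : ℕ => (K n : ℝ) ^ 2 * Real.log (p n)) =O[atTop] fun n : ℕ => √(n : ℝ)) :
    ∃ B : ℝ, 0 ≤ B ∧ ∀ᶠ n : ℕ in atTop,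
      2 * (4 * ((min (K n) (p n) : ℕ) * Real.log (p n + 1)
        + ((min (K n) (p n) : ℕ) + 1) / 2 * Real.log 2)) ^ 2 + 64 ≤ B * n := by
  obtain ⟨C, hC, h⟩ := hrate.exists_pos
  rw [IsBigOWith] at h
  -- From `2(8 + 12C√n)² + 64 ≤ 4(64 + 144C²n) + 64` and `n ≥ 1`.
  refine ⟨320 + 576 * C ^ 2, by positivity, ?_⟩
  filter_upwards [h, eventually_ge_atTop 1] with n hn hn1
  have hn1' : (1 : ℝ) ≤ n := by exact_mod_cast hn1
  rw [Real.norm_of_nonneg (Real.sqrt_nonneg _)] at hn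
  have h1 := (log_model_count_le (K n) (p n)).trans (by
    have := (Real.le_norm_self _).trans hn
    linarith : _ ≤ 8 + 12 * (C * √n))
  have h0 : 0 ≤ 4 * ((min (K n) (p n) : ℕ) * Real.log (p n + 1)
        + ((min (K n) (p n) : ℕ) + 1) / 2 * Real.log 2) := by
    have : 0 ≤ Real.log ((p n : ℝ) + 1) := Real.log_nonneg (by simp)
    have : 0 ≤ Real.log 2 := Real.log_nonneg (by norm_num)
    positivity
  have h2 := pow_le_pow_left₀ h0 h1 2
  have h3 : (C * √n) ^ 2 = C ^ 2 * n := by rw [mul_pow, Real.sq_sqrt (by positivity)]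
  nlinarith [sq_nonneg (8 - 12 * (C * √n))]

theorem second_moment_coefficient_le {σ δ α c B n : ℝ} (hσ : 0 < σ) (hα : 0 < α)
    (hαδ : α ≤ δ) (hc : 0 ≤ c) (hB : 0 ≤ B) (hn : 0 ≤ n) :
    9 * ((1 + 2 * σ ^ 2 + 2 * (σ ^ 2 / α)) * (c * n)
      + (96 * (σ ^ 4 + (σ ^ 2 / α) ^ 2) + 4 * σ ^ 2 * (σ ^ 2 / α)) * n
      + (5 * σ ^ 4 + 2 * σ ^ 2 + 2 * (σ ^ 2 / α) + 4 * σ ^ 2 * (σ ^ 2 / α)) * (B * n))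
      ≤ 9 * (((1 + 2 * σ ^ 2) * δ ^ 2 + 2 * σ ^ 2 * δ) * c
        + (96 * (σ ^ 4 * δ ^ 2 + σ ^ 4) + 4 * σ ^ 4 * δ)
        + ((5 * σ ^ 4 + 2 * σ ^ 2) * δ ^ 2 + 2 * σ ^ 2 * δ + 4 * σ ^ 4 * δ) * B)
        * (n / α ^ 2) := by
  calc _ = 9 * (((1 + 2 * σ ^ 2) * α ^ 2 + 2 * σ ^ 2 * α) * c
        + (96 * (σ ^ 4 * α ^ 2 + σ ^ 4) + 4 * σ ^ 4 * α)
        + ((5 * σ ^ 4 + 2 * σ ^ 2) * α ^ 2 + 2 * σ ^ 2 * α + 4 * σ ^ 4 * α) * B)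
        * (n / α ^ 2) := by field_simp
    _ ≤ _ := by gcongr

/-- The centre `m` is free, so the exact mean of the estimator is not needed; it is applied with `m
= σ²`. -/
theorem variance_div_le {Ω : Type*} [MeasurableSpace Ω] {P : Measure Ω} [IsProbabilityMeasure P]
    {T : Ω → ℝ} (hT : AEStronglyMeasurable T P) (m : ℝ) {n : ℝ} (hn : n ≠ 0) :
    Var[fun z => T z / n; P] ≤ (∫ z, (T z - m * n) ^ 2 ∂P) / n ^ 2 := by
  have hT' : AEStronglyMeasurable (fun z => T z / n) P := by
    simpa [div_eq_inv_mul] using hT.const_mul n⁻¹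
  rw [← variance_sub_const hT' m]
  refine (variance_le_expectation_sq (hT'.sub aestronglyMeasurable_const)).trans (le_of_eq ?_)
  rw [← integral_div]
  refine integral_congr_ae (ae_of_all _ fun z => ?_)
  simp only [Pi.pow_apply, Pi.sub_apply]
  field_simp

theorem integral_sub_sq_eq {Ω : Type*} [MeasurableSpace Ω] {P : Measure Ω}
    [IsProbabilityMeasure P] {T : Ω → ℝ} (hT : MemLp T 2 P) (a : ℝ) :
    ∫ z, (T z - a) ^ 2 ∂P = Var[T; P] + ((∫ z, T z ∂P) - a) ^ 2 := by
  have h1 : MemLp (fun z => T z - a) 2 P := hT.sub (memLp_const a)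
  have h2 := variance_eq_sub h1
  rw [variance_sub_const hT.aestronglyMeasurable, integral_sub (hT.integrable one_le_two)
    (integrable_const a)] at h2
  simp only [integral_const, probReal_univ, one_smul, Pi.pow_apply] at h2
  linarith

end Asymptotics

end SelectionPrediction

/-! ### Assembly of the asymptotic statements. -/

theorem mainTheorem2
    (σ δ : ℝ) (hσ : 0 < σ) (hδ : 0 < δ)
    -- for every sample size `n`: number of predictors, size bound, design, mean, selection rule
    (p K : ℕ → ℕ)
    (X : ∀ n : ℕ, Matrix (Fin n) (Fin (p n)) ℝ)
    (μ : ∀ n : ℕ, EuclideanSpace ℝ (Fin n))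
    (Mhat : ∀ n : ℕ, EuclideanSpace ℝ (Fin n) → Finset (Fin (p n)))
    -- the boundaries of the selection regions are Lebesgue null sets
    (hregion : ∀ n, ∀ M ∈ Set.range (Mhat n), volume (frontier (Mhat n ⁻¹' {M})) = 0)
    -- the hat matrices `X_M (X_Mᵀ X_M)⁻¹ X_Mᵀ` are well defined
    (hinv : ∀ n, ∀ M ∈ Set.range (Mhat n),
      IsUnit ((SelectionPrediction.subDesign (X n) M)ᵀ * SelectionPrediction.subDesign (X n) M))
    -- the models are small
    (hsize : ∀ n, ∀ M ∈ Set.range (Mhat n),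
      (SelectionPrediction.hatMatrix (X n) M).rank ≤ M.card ∧ M.card ≤ K n)
    (hrate : (fun n : ℕ => (K n : ℝ) ^ 2 * Real.log (p n)) =O[atTop] fun n : ℕ => √(n : ℝ))
    -- accuracy of the selection rule, uniformly over the variances in `[σ², (1 + δ) σ²]`
    (haccuracy : ∃ c : ℝ, ∀ᶠ n : ℕ in atTop, ∀ τ ∈ Set.Icc (σ ^ 2) ((1 + δ) * σ ^ 2),
      ∫ u, (‖μ n - SelectionPrediction.fit (X n) (Mhat n u) (μ n)‖ ^ 2) ^ 2
        ∂(SelectionPrediction.isoGaussian (μ n) τ) ≤ c * n) :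
    -- all the moments below are finite
    (∀ n, Integrable (SelectionPrediction.predLoss (X n) (Mhat n))
      ((SelectionPrediction.isoGaussian (μ n) (σ ^ 2)).prod
        (SelectionPrediction.isoGaussian (μ n) (σ ^ 2)))) ∧
    (∀ n, ∀ α : ℝ, 0 < α →
      MemLp (SelectionPrediction.errHat σ (X n) (Mhat n) α) 2
        (SelectionPrediction.randomizedLaw σ (μ n) α)) ∧
    -- bias
    (∃ C : ℝ, ∀ᶠ n : ℕ in atTop, ∀ α : ℝ, 0 < α → α ≤ δ →
      |(∫ z, SelectionPrediction.errHat σ (X n) (Mhat n) α z / n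
          ∂(SelectionPrediction.randomizedLaw σ (μ n) α))
        - SelectionPrediction.predError σ (X n) (μ n) (Mhat n) / n| ≤ C * α) ∧
    -- variance
    (∃ C : ℝ, ∀ᶠ n : ℕ in atTop, ∀ α : ℝ, 0 < α → α ≤ δ →
      variance (fun z => SelectionPrediction.errHat σ (X n) (Mhat n) α z / n)
        (SelectionPrediction.randomizedLaw σ (μ n) α) ≤ C * (1 / (n * α ^ 2))) ∧
    -- mean squared error for `α = n ^ (-1/4)`
    ((fun n : ℕ =>
        ∫ z, (SelectionPrediction.errHat σ (X n) (Mhat n) ((n : ℝ) ^ (-(1 / 4) : ℝ)) z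
            - SelectionPrediction.predError σ (X n) (μ n) (Mhat n)) ^ 2 / (n : ℝ) ^ 2
          ∂(SelectionPrediction.randomizedLaw σ (μ n) ((n : ℝ) ^ (-(1 / 4) : ℝ))))
      =O[atTop] fun n : ℕ => (n : ℝ) ^ (-(1 / 2) : ℝ)) ∧
    -- convergence in `L²`
    Tendsto (fun n : ℕ =>
        eLpNorm (fun z =>
            SelectionPrediction.errHat σ (X n) (Mhat n) ((n : ℝ) ^ (-(1 / 4) : ℝ)) z / n
              - SelectionPrediction.predError σ (X n) (μ n) (Mhat n) / n) 2
          (SelectionPrediction.randomizedLaw σ (μ n) ((n : ℝ) ^ (-(1 / 4) : ℝ))))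
      atTop (𝓝 0) := by
  obtain ⟨c, hc⟩ := haccuracy
  obtain ⟨B, hB0, hB⟩ := SelectionPrediction.exists_envelope_bound hrate
  have hcard : ∀ n, ∀ M ∈ Set.range (Mhat n), M.card ≤ min (K n) (p n) := fun n M hM =>
    le_min (hsize n M hM).2 (by simpa using M.card_le_univ)
  -- The threshold `l` and the envelope bound `q` take their least admissible values, the ones
  -- estimated by `exists_envelope_bound`.
  have hfin := fun n => SelectionPrediction.finite_sample_bounds (X n) (μ n) (Mhat n) (hregion n)
    (hinv n) (hcard n) le_rfl le_rfl hσ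
  have hprob := fun n α => SelectionPrediction.isProbabilityMeasure_randomizedLaw σ (μ n) α
  have hmem : ∀ n, ∀ α : ℝ, 0 < α →
      MemLp (SelectionPrediction.errHat σ (X n) (Mhat n) α) 2
        (SelectionPrediction.randomizedLaw σ (μ n) α) := fun n α hα => ((hfin n).2 α hα).1
  -- both bounds for `errHat / n`, for large `n` and all `α ≤ δ`
  obtain ⟨Cb, hbias⟩ : ∃ C : ℝ, ∀ᶠ n : ℕ in atTop, ∀ α : ℝ, 0 < α → α ≤ δ →
      |(∫ z, SelectionPrediction.errHat σ (X n) (Mhat n) α z / n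
          ∂(SelectionPrediction.randomizedLaw σ (μ n) α))
        - SelectionPrediction.predError σ (X n) (μ n) (Mhat n) / n| ≤ C * α := by
    refine ⟨σ ^ 2 * (|c| + ((1 + δ) * σ ^ 2) ^ 2 * B + 12 / σ ^ 4 + 3 / 2 * (1 + B)), ?_⟩
    filter_upwards [hc, hB, eventually_ge_atTop 1] with n hcn hBn hn1 α hα hαδ
    have hn : (1 : ℝ) ≤ n := by exact_mod_cast hn1
    -- For `α ≤ δ` all variances involved lie in the range where accuracy is assumed. The absolute
    -- value makes the constant nonnegative, as the later monotonicity steps require.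
    have h := (((hfin n).2 α hα).2 (|c| * n) fun τ hτ =>
      (hcn τ ⟨hτ.1, hτ.2.trans (by gcongr)⟩).trans (by gcongr; exact le_abs_self c)).1
    rw [integral_div, ← sub_div, abs_div, abs_of_pos (by positivity : (0 : ℝ) < n),
      div_le_iff₀ (by positivity)]
    refine h.trans ?_
    calc _ ≤ α * σ ^ 2 * (|c| * n + ((1 + δ) * σ ^ 2) ^ 2 * (B * n) + 12 * n / σ ^ 4
          + 3 / 2 * (n + B * n)) := by gcongr
      _ = _ := by ring
  obtain ⟨Cv, hvar⟩ : ∃ C : ℝ, ∀ᶠ n : ℕ in atTop, ∀ α : ℝ, 0 < α → α ≤ δ →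
      variance (fun z => SelectionPrediction.errHat σ (X n) (Mhat n) α z / n)
        (SelectionPrediction.randomizedLaw σ (μ n) α) ≤ C * (1 / (n * α ^ 2)) := by
    refine ⟨9 * (((1 + 2 * σ ^ 2) * δ ^ 2 + 2 * σ ^ 2 * δ) * |c|
        + (96 * (σ ^ 4 * δ ^ 2 + σ ^ 4) + 4 * σ ^ 4 * δ)
        + ((5 * σ ^ 4 + 2 * σ ^ 2) * δ ^ 2 + 2 * σ ^ 2 * δ + 4 * σ ^ 4 * δ) * B), ?_⟩
    filter_upwards [hc, hB, eventually_ge_atTop 1] with n hcn hBn hn1 α hα hαδ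
    have hn : (1 : ℝ) ≤ n := by exact_mod_cast hn1
    have h := (((hfin n).2 α hα).2 (|c| * n) fun τ hτ =>
      (hcn τ ⟨hτ.1, hτ.2.trans (by gcongr)⟩).trans (by gcongr; exact le_abs_self c)).2
    have hn0 : (n : ℝ) ≠ 0 := by positivity
    refine (SelectionPrediction.variance_div_le (hmem n α hα).aestronglyMeasurable (σ ^ 2)
      hn0).trans ?_
    rw [div_le_iff₀ (by positivity)]
    refine h.trans (le_trans (by gcongr) ((SelectionPrediction.second_moment_coefficient_le hσ hα
      hαδ (abs_nonneg c) hB0 (by positivity : (0 : ℝ) ≤ n)).trans (le_of_eq ?_)))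
    field_simp
  -- the mean squared error, as variance plus squared bias
  have hα0 : ∀ᶠ n : ℕ in atTop, (0 : ℝ) < (n : ℝ) ^ (-(1 / 4) : ℝ) := by
    filter_upwards [eventually_ge_atTop 1] with n hn
    have : (0 : ℝ) < n := by exact_mod_cast hn
    positivity
  have hαδ : ∀ᶠ n : ℕ in atTop, (n : ℝ) ^ (-(1 / 4) : ℝ) ≤ δ :=
    ((tendsto_rpow_neg_atTop (by norm_num : (0 : ℝ) < 1 / 4)).comp
      tendsto_natCast_atTop_atTop).eventually_le_const hδ
  have hmse : (fun n : ℕ =>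
        ∫ z, (SelectionPrediction.errHat σ (X n) (Mhat n) ((n : ℝ) ^ (-(1 / 4) : ℝ)) z
            - SelectionPrediction.predError σ (X n) (μ n) (Mhat n)) ^ 2 / (n : ℝ) ^ 2
          ∂(SelectionPrediction.randomizedLaw σ (μ n) ((n : ℝ) ^ (-(1 / 4) : ℝ))))
      =O[atTop] fun n : ℕ => (n : ℝ) ^ (-(1 / 2) : ℝ) := by
    refine IsBigO.of_bound (Cv + Cb ^ 2) ?_
    filter_upwards [hbias, hvar, hα0, hαδ, eventually_ge_atTop 1] with n hb hv hα hαδ hn1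
    have hn : (0 : ℝ) < n := by exact_mod_cast hn1
    set α : ℝ := (n : ℝ) ^ (-(1 / 4) : ℝ) with hαdef
    have hα2 : α ^ 2 = (n : ℝ) ^ (-(1 / 2) : ℝ) := by
      rw [hαdef, ← Real.rpow_natCast, ← Real.rpow_mul hn.le]; norm_num
    have hnα : 1 / (n * α ^ 2) = (n : ℝ) ^ (-(1 / 2) : ℝ) := by
      rw [hα2, one_div, ← Real.rpow_neg_one, ← Real.rpow_one_add' hn.le (by norm_num),
        ← Real.rpow_mul hn.le]
      norm_num
    have h1 := hb α hα hαδ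
    have h2 := hv α hα hαδ
    rw [hnα] at h2
    have h3 := pow_le_pow_left₀ (abs_nonneg _) h1 2
    rw [sq_abs, mul_pow, hα2] at h3
    have hL : MemLp (fun z => SelectionPrediction.errHat σ (X n) (Mhat n) α z / n) 2
        (SelectionPrediction.randomizedLaw σ (μ n) α) := by
      simpa [div_eq_inv_mul] using (hmem n α hα).const_mul ((n : ℝ)⁻¹)
    have h4 := SelectionPrediction.integral_sub_sq_eq hL
      (SelectionPrediction.predError σ (X n) (μ n) (Mhat n) / n)
    have h5 : ∀ z, (SelectionPrediction.errHat σ (X n) (Mhat n) α z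
        - SelectionPrediction.predError σ (X n) (μ n) (Mhat n)) ^ 2 / (n : ℝ) ^ 2
        = (SelectionPrediction.errHat σ (X n) (Mhat n) α z / n
          - SelectionPrediction.predError σ (X n) (μ n) (Mhat n) / n) ^ 2 := fun z => by
      rw [← div_pow, sub_div]
    simp_rw [h5]
    rw [Real.norm_of_nonneg (integral_nonneg fun z => sq_nonneg _),
      Real.norm_of_nonneg (by positivity), h4]
    linarith
  refine ⟨fun n => (hfin n).1, hmem, ⟨Cb, hbias⟩, ⟨Cv, hvar⟩, hmse, ?_⟩
  have hlim := hmse.trans_tendsto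
    ((tendsto_rpow_neg_atTop (by norm_num : (0 : ℝ) < 1 / 2)).comp tendsto_natCast_atTop_atTop)
  have hlim2 : Tendsto (fun n : ℕ => ENNReal.ofReal (√(
      ∫ z, (SelectionPrediction.errHat σ (X n) (Mhat n) ((n : ℝ) ^ (-(1 / 4) : ℝ)) z
            - SelectionPrediction.predError σ (X n) (μ n) (Mhat n)) ^ 2 / (n : ℝ) ^ 2
          ∂(SelectionPrediction.randomizedLaw σ (μ n) ((n : ℝ) ^ (-(1 / 4) : ℝ))))))
      atTop (𝓝 0) := by
    have := ENNReal.tendsto_ofReal hlim.sqrt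
    simpa using this
  refine hlim2.congr' ?_
  filter_upwards [hα0] with n hα
  have hL : MemLp (fun z => SelectionPrediction.errHat σ (X n) (Mhat n)
      ((n : ℝ) ^ (-(1 / 4) : ℝ)) z / n
        - SelectionPrediction.predError σ (X n) (μ n) (Mhat n) / n) 2
      (SelectionPrediction.randomizedLaw σ (μ n) ((n : ℝ) ^ (-(1 / 4) : ℝ))) := by
    have := ((hmem n _ hα).const_mul ((n : ℝ)⁻¹)).sub
      (memLp_const (SelectionPrediction.predError σ (X n) (μ n) (Mhat n) / n))
    exact this.ae_eq (ae_of_all _ fun z => by simp [div_eq_inv_mul])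
  -- The `L²` norm is the square root of the mean squared error already shown to vanish.
  rw [hL.eLpNorm_eq_integral_rpow_norm two_ne_zero ENNReal.ofNat_ne_top]
  simp only [ENNReal.toReal_ofNat, Real.rpow_ofNat, Real.norm_eq_abs, sq_abs]
  rw [Real.sqrt_eq_rpow, show (2 : ℝ)⁻¹ = 1 / 2 by norm_num]
  congr 3
  ext z
  rw [← div_pow, sub_div]
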